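/- **Setting.** Let $\mathsf{Sig}$ be the category of spans $\mathbb N\xleftarrow{}\Sigma\xrightarrow{}\mathbb N$ of sets, equivalently of families $(\Sigma(n,m))_{n,m\in\mathbb N}$ of sets. Let $A$ be a set of labels and $\kappa$ an infinite cardinal with $|A|\le\kappa$. Let $\mathcal F\colon\mathsf{Sig}\to\mathsf{Sig}$ be the functor with $$\mathcal F(\Sigma)(n,m)=\{U\subseteq A^n\times\Sigma(n,m)\times A^m : |U|\le\kappa\},$$ acting on morphisms by direct image; write $\xrightarrow[b]{a}c'$ for a triple $(a,c',b)$. (This is $\overline{\mathcal P}_\kappa(L;\mathrm{Id};L)$ with $L$ the span of words over $A$, both legs being the length.) Let $\mathcal S_{SM}=(\mathrm{Id};\mathrm{Id})+\iota+(\mathrm{Id}\otimes\mathrm{Id})+\epsilon+\sigma$ be the endofunctor of $\mathsf{Sig}$ whose summands stand for sequential composition $c;d$ (for $c\in\Sigma(n,k)$, $d\in\Sigma(k,m)$), an identity $\mathrm{id}_1$ of type $(1,1)$, monoidal product $c\otimes d$ (adding arities and coarities), a unit $\epsilon$ of type $(0,0)$, and a symmetry $\sigma$ of type $(2,2)$.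 Let $\mathcal S_{SM}^\dagger$ be the free monad on it (terms). Let $\mathbb E_{SM}$ be the equations $$(f\otimes g)\otimes h=f\otimes(g\otimes h),\quad \epsilon\otimes f=f=f\otimes\epsilon,\quad \sigma;\sigma=\mathrm{id}_2,\quad (f;g)\otimes(h;i)=(f\otimes h);(g\otimes i),$$ $$(f;g);h=f;(g;h),\quad f;\mathrm{id}_m=f=\mathrm{id}_n;f,\quad \sigma_{1,n};(f\otimes\mathrm{id}_1)=(\mathrm{id}_1\otimes f);\sigma_{1,m},\quad \sigma_{n,1};(\mathrm{id}_1\otimes f)=(f\otimes\mathrm{id}_1);\sigma_{m,1}$$ (with $f$ of type $(n,m)$ wherever $n$ and $m$ occur, and $\mathrm{id}_n$, $\sigma_{1,n}$, $\sigma_{n,1}$ defined recursively), and let $q\colon\mathcal S_{SM}^\dagger\Rightarrow\mathcal S_{PROP}$ be the quotient monad of terms modulo the congruence generated by $\mathbb E_{SM}$. A prop is a symmetric strict monoidal category with objects the natural numbers and addition as monoidal product on objects; prop morphisms are identity-on-objects symmetric strict monoidal functors. An $\mathcal S_{PROP}$-algebra on $\Omega\in\mathsf{Sig}$ is said to be that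 of a prop with hom-sets $\Omega(n,m)$ if the operations $;$, $\otimes$, $\mathrm{id}_0$, $\mathrm{id}_1$, $\sigma_{1,1}$ of the prop are the interpretations of $;$, $\otimes$, $\epsilon$, $\mathrm{id}_1$, $\sigma$ in the algebra. Let $\lambda\colon\mathcal S_{SM}\mathcal F\Rightarrow\mathcal F\mathcal S_{SM}^\dagger$ be the GSOS specification given by the rules $$\frac{c\xrightarrow[b]{a}c'\quad d\xrightarrow[e]{b}d'}{c;d\xrightarrow[e]{a}c';d'}\qquad \frac{}{\mathrm{id}_1\xrightarrow[k]{k}\mathrm{id}_1}\qquad \frac{c\xrightarrow[b_1]{a_1}c'\quad d\xrightarrow[b_2]{a_2}d'}{c\otimes d\xrightarrow[b_1b_2]{a_1a_2}c'\otimes d'}\qquad \frac{}{\epsilon\xrightarrow[\varepsilon]{\varepsilon}\epsilon}\qquad \frac{}{\sigma\xrightarrow[lk]{kl}\sigma}$$ with $k,l\in A$, words $a,b,e,a_i,b_i$ over $A$, and $\varepsilon$ the empty word. **Theorem.** 1. $\lambda$ induces a unique distributive law $\lambda^\dagger\colon\mathcal S_{SM}^\dagger\mathcal F\Rightarrow\mathcal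 F\mathcal S_{SM}^\dagger$ of the monad $\mathcal S_{SM}^\dagger$ over $\mathcal F$, and $\lambda^\dagger$ preserves $\mathbb E_{SM}$: the two sides of each equation, regarded as natural transformations $l,r$ into $\mathcal S_{SM}^\dagger$, satisfy $\mathcal Fq\circ\lambda^\dagger\circ l_{\mathcal F}=\mathcal Fq\circ\lambda^\dagger\circ r_{\mathcal F}$. 2. Hence there is a unique distributive law $\lambda_{/SM}\colon\mathcal S_{PROP}\mathcal F\Rightarrow\mathcal F\mathcal S_{PROP}$ of the monad $\mathcal S_{PROP}$ over $\mathcal F$ with $\lambda_{/SM}\circ q_{\mathcal F}=\mathcal Fq\circ\lambda^\dagger$. 3. A final $\mathcal F$-coalgebra exists. Every final $\mathcal F$-coalgebra $(\Omega,\omega)$ carries a unique $\mathcal S_{PROP}$-algebra structure making it a $\lambda_{/SM}$-bialgebra, and this algebra structure is that of a (unique) prop on $\Omega$. 4. Let $\Sigma\in\mathsf{Sig}$ and $\beta\colon\Sigma\to\mathcal F\mathcal S_{PROP}(\Sigma)$, and let $\beta^\sharp=\mathcal F\mu\circ\lambda_{/SM}\circ\mathcal S_{PROP}\beta\colon\mathcal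 S_{PROP}(\Sigma)\to\mathcal F\mathcal S_{PROP}(\Sigma)$, where $\mu$ is the multiplication of $\mathcal S_{PROP}$. Then $(\mathcal S_{PROP}(\Sigma),\mu,\beta^\sharp)$ is a $\lambda_{/SM}$-bialgebra; its algebra structure is that of a (unique) prop; and the unique coalgebra morphism $[\![\cdot]\!]_\beta\colon(\mathcal S_{PROP}(\Sigma),\beta^\sharp)\to(\Omega,\omega)$ is an $\mathcal S_{PROP}$-algebra morphism and a prop morphism: it preserves identities, symmetries, $;$ and $\otimes$. Two diagrams $c,d\in\mathcal S_{PROP}(\Sigma)(n,m)$ are bisimilar for $\beta^\sharp$ if and only if $[\![c]\!]_\beta=[\![d]\!]_\beta$, and bisimilarity is an equivalence relation that is a congruence for $;$ and $\otimes$. -/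

import Mathlib

open CategoryTheory Cardinal

universe u v w

/-! ## Distributive laws, monad equations and bialgebras in an arbitrary category -/

section Bialgebraic

variable {C : Type v} [Category.{w} C]

/-- A distributive law `T F ⇒ F T` of a monad `T` over an endofunctor `F`.
(In Mathlib, `F ⋙ T` is "first `F`, then `T`".) -/
@[ext]
structure DistributiveLaw (T : Monad C) (F : C ⥤ C) where
  nat : F ⋙ T.toFunctor ⟶ T.toFunctor ⋙ F
  unit : ∀ X : C, T.η.app (F.obj X) ≫ nat.app X = F.map (T.η.app X)
  mul : ∀ X : C, T.μ.app (F.obj X) ≫ nat.app X =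
    T.map (nat.app X) ≫ nat.app (T.obj X) ≫ F.map (T.μ.app X)

/-- `T`-equations: a functor `A` of variables and two natural transformations `l r : A ⇒ T`
giving the left-hand and right-hand sides. -/
structure MonadEquations (T : Monad C) where
  A : C ⥤ C
  l : A ⟶ T.toFunctor
  r : A ⟶ T.toFunctor

/-- The distributive law `d` preserves the equations `E`, where `q : T ⇒ Q` is the projection of
`T` onto its quotient by `E`. -/
def DistributiveLaw.Preserves {T Q : Monad C} {F : C ⥤ C} (d : DistributiveLaw T F)
    (E : MonadEquations T) (q : T ⟶ Q) : Prop :=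
  ∀ X : C, E.l.app (F.obj X) ≫ d.nat.app X ≫ F.map (q.app X) =
    E.r.app (F.obj X) ≫ d.nat.app X ≫ F.map (q.app X)

/-- The distributive law `e` of `Q` is the quotient of the distributive law `d` of `T` along the
monad morphism `q : T ⇒ Q`. -/
def DistributiveLaw.IsQuotient {T Q : Monad C} {F : C ⥤ C} (d : DistributiveLaw T F)
    (e : DistributiveLaw Q F) (q : T ⟶ Q) : Prop :=
  ∀ X : C, q.app (F.obj X) ≫ e.nat.app X = d.nat.app X ≫ F.map (q.app X)

/-- `(X, a, c)` is a `d`-bialgebra: `a` is an Eilenberg-Moore algebra for `T`, `c` is an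
`F`-coalgebra, and `a`, `c` are compatible via `d`. -/
structure IsBialgebra {T : Monad C} {F : C ⥤ C} (d : DistributiveLaw T F) {X : C}
    (a : T.obj X ⟶ X) (c : X ⟶ F.obj X) : Prop where
  unit : T.η.app X ≫ a = 𝟙 X
  assoc : T.μ.app X ≫ a = T.map a ≫ a
  compat : T.map c ≫ d.nat.app X ≫ F.map a = a ≫ c

/-- The extension `β♯ : T X ⟶ F T X` of `β : X ⟶ F T X` along a distributive law. -/
def DistributiveLaw.sharp {T : Monad C} {F : C ⥤ C} (d : DistributiveLaw T F) {X : C}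
    (β : X ⟶ F.obj (T.obj X)) : T.obj X ⟶ F.obj (T.obj X) :=
  T.map β ≫ d.nat.app (T.obj X) ≫ F.map (T.μ.app X)

end Bialgebraic

/-! ## Signatures -/

/-- A signature: a span `ℕ ← Σ → ℕ`, presented by its fibres, i.e. as a presheaf on the discrete
category `ℕ × ℕ`; `X n m` is the set of operations of arity `n` and coarity `m`. -/
def Sig : Type (u + 1) := ℕ → ℕ → Type u

namespace Sig

/-- A morphism of signatures: a function preserving arity and coarity. -/
@[ext]
structure Hom (X Y : Sig.{u}) : Type u where
  app : ∀ {n m : ℕ}, X n m → Y n m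

instance : Category Sig.{u} where
  Hom := Hom
  id _ := ⟨fun x => x⟩
  comp f g := ⟨fun x => g.app (f.app x)⟩

@[ext]
theorem hom_ext {X Y : Sig.{u}} {f g : X ⟶ Y}
    (h : ∀ (n m : ℕ) (x : X n m), f.app x = g.app x) : f = g := by
  apply Hom.ext
  funext n m x
  exact h n m x

@[simp] theorem id_app {X : Sig.{u}} {n m : ℕ} (x : X n m) : Hom.app (𝟙 X) x = x := rfl

@[simp] theorem comp_app {X Y Z : Sig.{u}} (f : X ⟶ Y) (g : Y ⟶ Z) {n m : ℕ} (x : X n m) :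
    Hom.app (f ≫ g) x = g.app (f.app x) := rfl

/-- Transport of an operation along equalities of its arity and coarity. -/
def cast (X : Sig.{u}) {n m n' m' : ℕ} (hn : n = n') (hm : m = m') (x : X n m) : X n' m' :=
  hm ▸ hn ▸ x

theorem app_cast {X Y : Sig.{u}} (f : X ⟶ Y) {n m n' m' : ℕ} (hn : n = n') (hm : m = m')
    (x : X n m) : f.app (X.cast hn hm x) = Y.cast hn hm (f.app x) := by
  subst hn hm; rfl

end Sig

/-! ## Props -/

/-- The structure of a prop on a family `H` of hom-sets: a symmetric strict monoidal category with
objects the natural numbers and addition as the monoidal product on objects. Composition is in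
diagrammatic order. -/
@[ext]
structure PropStr (H : Sig.{u}) where
  id : ∀ n : ℕ, H n n
  seq : ∀ {n k m : ℕ}, H n k → H k m → H n m
  par : ∀ {n m n' m' : ℕ}, H n m → H n' m' → H (n + n') (m + m')
  symm : ∀ n m : ℕ, H (n + m) (m + n)
  id_seq : ∀ {n m : ℕ} (f : H n m), seq (id n) f = f
  seq_id : ∀ {n m : ℕ} (f : H n m), seq f (id m) = f
  seq_assoc : ∀ {n k l m : ℕ} (f : H n k) (g : H k l) (h : H l m),
    seq (seq f g) h = seq f (seq g h)
  par_id : ∀ n m : ℕ, par (id n) (id m) = id (n + m)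
  par_seq : ∀ {a b c a' b' c' : ℕ} (f : H a b) (g : H b c) (f' : H a' b') (g' : H b' c'),
    par (seq f g) (seq f' g') = seq (par f f') (par g g')
  par_assoc : ∀ {a b a' b' a'' b'' : ℕ} (f : H a b) (g : H a' b') (h : H a'' b''),
    H.cast (Nat.add_assoc a a' a'') (Nat.add_assoc b b' b'') (par (par f g) h) =
      par f (par g h)
  zero_par : ∀ {n m : ℕ} (f : H n m),
    H.cast (Nat.zero_add n) (Nat.zero_add m) (par (id 0) f) = f
  par_zero : ∀ {n m : ℕ} (f : H n m), par f (id 0) = f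
  symm_natural : ∀ {n n' m m' : ℕ} (f : H n n') (g : H m m'),
    seq (symm n m) (par g f) = seq (par f g) (symm n' m')
  symm_symm : ∀ n m : ℕ, seq (symm n m) (symm m n) = id (n + m)
  hexagon : ∀ n m p : ℕ,
    seq (par (symm n m) (id p))
        (H.cast (Nat.add_assoc m n p).symm (Nat.add_assoc m p n).symm (par (id m) (symm n p))) =
      H.cast (Nat.add_assoc n m p).symm rfl (symm n (m + p))

/-- A morphism of props: an identity-on-objects symmetric strict monoidal functor. -/
structure IsPropHom {X Y : Sig.{u}} (P : PropStr X) (Q : PropStr Y) (f : X ⟶ Y) : Prop where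
  map_id : ∀ n : ℕ, f.app (P.id n) = Q.id n
  map_seq : ∀ {n k m : ℕ} (x : X n k) (y : X k m),
    f.app (P.seq x y) = Q.seq (f.app x) (f.app y)
  map_par : ∀ {n m n' m' : ℕ} (x : X n m) (y : X n' m'),
    f.app (P.par x y) = Q.par (f.app x) (f.app y)
  map_symm : ∀ n m : ℕ, f.app (P.symm n m) = Q.symm n m

/-! ## The signature functor of symmetric monoidal operations and its free monad -/

/-- The coproduct `(X ; X) + ι + (X ⊗ X) + ε + σ` of signatures. -/
inductive SMOp (X : Sig.{u}) : ℕ → ℕ → Type u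
  | seq {n k m : ℕ} (x : X n k) (y : X k m) : SMOp X n m
  | id1 : SMOp X 1 1
  | par {n m n' m' : ℕ} (x : X n m) (y : X n' m') : SMOp X (n + n') (m + m')
  | eps : SMOp X 0 0
  | sym : SMOp X 2 2

/-- Terms over the signature `X`, built with sequential composition, the identity on `1`, the
monoidal product, its unit and the basic symmetry. -/
inductive SMTerm (X : Sig.{u}) : ℕ → ℕ → Type u
  | var {n m : ℕ} (x : X n m) : SMTerm X n m
  | seq {n k m : ℕ} (s : SMTerm X n k) (t : SMTerm X k m) : SMTerm X n m
  | id1 : SMTerm X 1 1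
  | par {n m n' m' : ℕ} (s : SMTerm X n m) (t : SMTerm X n' m') : SMTerm X (n + n') (m + m')
  | eps : SMTerm X 0 0
  | sym : SMTerm X 2 2

/-- `SMOp X` as an object of `Sig`. -/
def SMOpSig (X : Sig.{u}) : Sig.{u} := SMOp X

/-- `SMTerm X` as an object of `Sig`. -/
def SMTermSig (X : Sig.{u}) : Sig.{u} := SMTerm X

def SMOp.map {X Y : Sig.{u}} (f : X ⟶ Y) : ∀ {n m : ℕ}, SMOp X n m → SMOp Y n m
  | _, _, .seq x y => .seq (f.app x) (f.app y)
  | _, _, .id1 => .id1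
  | _, _, .par x y => .par (f.app x) (f.app y)
  | _, _, .eps => .eps
  | _, _, .sym => .sym

/-- The endofunctor `S_SM = (Id ; Id) + ι + (Id ⊗ Id) + ε + σ` of `Sig`. -/
def SM : Sig.{u} ⥤ Sig.{u} where
  obj := SMOpSig
  map f := ⟨SMOp.map f⟩
  map_id X := by
    ext n m x
    change SMOp X n m at x
    cases x <;> rfl
  map_comp {X Y Z} f g := by
    ext n m x
    change SMOp X n m at x
    cases x <;> rfl

namespace SMTerm

/-- The `S_SM`-algebra structure on terms. -/
def node {X : Sig.{u}} : ∀ {n m : ℕ}, SMOp (SMTermSig X) n m → SMTerm X n m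
  | _, _, .seq s t => .seq s t
  | _, _, .id1 => .id1
  | _, _, .par s t => .par s t
  | _, _, .eps => .eps
  | _, _, .sym => .sym

/-- Evaluation of terms in an `S_SM`-algebra `op : S_SM Y ⟶ Y`. -/
def fold {X Y : Sig.{u}} (f : X ⟶ Y) (op : SM.obj Y ⟶ Y) : ∀ {n m : ℕ}, SMTerm X n m → Y n m
  | _, _, .var x => f.app x
  | _, _, .seq s t => op.app (SMOp.seq (fold f op s) (fold f op t))
  | _, _, .id1 => op.app SMOp.id1
  | _, _, .par s t => op.app (SMOp.par (fold f op s) (fold f op t))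
  | _, _, .eps => op.app SMOp.eps
  | _, _, .sym => op.app SMOp.sym

/-- The structure map of the free `S_SM`-algebra. -/
def nodeHom (X : Sig.{u}) : SM.obj (SMTermSig X) ⟶ SMTermSig X := ⟨node⟩

/-- The inclusion of generators. -/
def varHom (X : Sig.{u}) : X ⟶ SMTermSig X := ⟨var⟩

def foldHom {X Y : Sig.{u}} (f : X ⟶ Y) (op : SM.obj Y ⟶ Y) : SMTermSig X ⟶ Y := ⟨fold f op⟩

/-- Renaming of generators. -/
def mapHom {X Y : Sig.{u}} (f : X ⟶ Y) : SMTermSig X ⟶ SMTermSig Y :=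
  foldHom (f ≫ varHom Y) (nodeHom Y)

/-- Flattening of terms of terms. -/
def joinHom (X : Sig.{u}) : SMTermSig (SMTermSig X) ⟶ SMTermSig X :=
  foldHom (𝟙 _) (nodeHom X)

theorem nodeHom_foldHom {X Y : Sig.{u}} (f : X ⟶ Y) (op : SM.obj Y ⟶ Y) :
    nodeHom X ≫ foldHom f op = SM.map (foldHom f op) ≫ op := by
  ext n m x
  change SMOp (SMTermSig X) n m at x
  cases x <;> rfl

theorem varHom_foldHom {X Y : Sig.{u}} (f : X ⟶ Y) (op : SM.obj Y ⟶ Y) :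
    varHom X ≫ foldHom f op = f := rfl

theorem foldHom_unique {X Y : Sig.{u}} (f : X ⟶ Y) (op : SM.obj Y ⟶ Y) (h : SMTermSig X ⟶ Y)
    (hvar : varHom X ≫ h = f) (hnode : nodeHom X ≫ h = SM.map h ≫ op) :
    h = foldHom f op := by
  have key : ∀ {n m : ℕ} (o : SMOp (SMTermSig X) n m),
      h.app (node o) = op.app (SMOp.map h o) := fun o =>
    congrArg (fun k : SM.obj (SMTermSig X) ⟶ Y => k.app o) hnode
  ext n m t
  change SMTerm X n m at t
  induction t with
  | var x => exact congrArg (fun k : X ⟶ Y => k.app x) hvar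
  | seq s t ihs iht =>
    refine (key (.seq s t)).trans ?_
    change op.app (SMOp.seq (h.app s) (h.app t)) = _
    rw [ihs, iht]; rfl
  | id1 => exact key .id1
  | par s t ihs iht =>
    refine (key (.par s t)).trans ?_
    change op.app (SMOp.par (h.app s) (h.app t)) = _
    rw [ihs, iht]; rfl
  | eps => exact key .eps
  | sym => exact key .sym

theorem foldHom_comp {X Y Z : Sig.{u}} (f : X ⟶ Y) (op : SM.obj Y ⟶ Y) (op' : SM.obj Z ⟶ Z)
    (h : Y ⟶ Z) (hh : op ≫ h = SM.map h ≫ op') :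
    foldHom f op ≫ h = foldHom (f ≫ h) op' := by
  apply foldHom_unique
  · rw [← Category.assoc, varHom_foldHom]
  · rw [← Category.assoc, nodeHom_foldHom, Category.assoc, hh, ← Category.assoc, ← SM.map_comp]

theorem mapHom_foldHom {W X Y : Sig.{u}} (g : W ⟶ X) (f : X ⟶ Y) (op : SM.obj Y ⟶ Y) :
    mapHom g ≫ foldHom f op = foldHom (g ≫ f) op := by
  rw [mapHom, foldHom_comp _ _ op _ (nodeHom_foldHom f op), Category.assoc, varHom_foldHom]

theorem foldHom_var (X : Sig.{u}) : foldHom (varHom X) (nodeHom X) = 𝟙 _ := by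
  symm
  apply foldHom_unique
  · exact Category.comp_id _
  · rw [Category.comp_id, SM.map_id, Category.id_comp]

end SMTerm

open SMTerm in
/-- The free monad `S_SM†` of terms. -/
def SMMonad : Monad Sig.{u} where
  obj := SMTermSig
  map := mapHom
  map_id X := by rw [mapHom, Category.id_comp, foldHom_var]
  map_comp {X Y Z} f g := by
    change mapHom (f ≫ g) = mapHom f ≫ foldHom (g ≫ varHom Z) (nodeHom Z)
    rw [mapHom_foldHom, mapHom, Category.assoc]
  η := { app := varHom, naturality := fun _ _ _ => rfl }
  μ :=
    { app := joinHom
      naturality := fun X Y f => by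
        change mapHom (mapHom f) ≫ joinHom Y = joinHom X ≫ mapHom f
        rw [joinHom, joinHom, mapHom_foldHom, Category.comp_id]
        refine Eq.symm ((foldHom_comp _ _ (nodeHom Y) (mapHom f) (nodeHom_foldHom _ _)).trans ?_)
        rw [Category.id_comp] }
  assoc X := by
    change mapHom (joinHom X) ≫ joinHom X = joinHom (SMTermSig X) ≫ joinHom X
    rw [joinHom, joinHom, mapHom_foldHom, foldHom_comp _ _ (nodeHom X) _ (nodeHom_foldHom _ _),
      Category.comp_id, Category.id_comp]
  left_unit X := rfl
  right_unit X := by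
    change mapHom (varHom X) ≫ joinHom X = 𝟙 _
    rw [joinHom, mapHom_foldHom, Category.comp_id, foldHom_var]

/-! ## The equations of symmetric strict monoidal categories -/

namespace SMTerm

/-- The identity on `n`: the monoidal product of `n` copies of the identity on `1`. -/
def idn (X : Sig.{u}) : ∀ n : ℕ, SMTerm X n n
  | 0 => .eps
  | n + 1 => .par (idn X n) .id1

/-- The symmetry `σ_{1,n}`. -/
def symOne (X : Sig.{u}) : ∀ n : ℕ, SMTerm X (1 + n) (n + 1)
  | 0 => .id1
  | n + 1 => .seq (.par (symOne X n) .id1 : SMTerm X (1 + n + 1) (n + 1 + 1))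
      (.par (idn X n) .sym : SMTerm X (n + 2) (n + 2))

/-- The symmetry `σ_{n,1}`. -/
def oneSym (X : Sig.{u}) : ∀ n : ℕ, SMTerm X (n + 1) (1 + n)
  | 0 => .id1
  | n + 1 => .seq (.par (idn X n) .sym : SMTerm X (n + 2) (n + 2))
      (.par (oneSym X n) .id1 : SMTerm X (n + 1 + 1) (1 + n + 1))

end SMTerm

/-- The variables of the ten equations, one summand per equation. -/
inductive SMEq (X : Sig.{u}) : ℕ → ℕ → Type u
  | parAssoc {a b a' b' a'' b'' : ℕ} (f : X a b) (g : X a' b') (h : X a'' b'') :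
      SMEq X (a + (a' + a'')) (b + (b' + b''))
  | epsPar {n m : ℕ} (f : X n m) : SMEq X n m
  | parEps {n m : ℕ} (f : X n m) : SMEq X n m
  | symSym : SMEq X 2 2
  | interchange {a b c a' b' c' : ℕ} (f : X a b) (g : X b c) (h : X a' b') (i : X b' c') :
      SMEq X (a + a') (c + c')
  | seqAssoc {n k l m : ℕ} (f : X n k) (g : X k l) (h : X l m) : SMEq X n m
  | seqId {n m : ℕ} (f : X n m) : SMEq X n m
  | idSeq {n m : ℕ} (f : X n m) : SMEq X n m
  | symOneNat {n m : ℕ} (f : X n m) : SMEq X (1 + n) (m + 1)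
  | oneSymNat {n m : ℕ} (g : X n m) : SMEq X (n + 1) (1 + m)

def SMEqSig (X : Sig.{u}) : Sig.{u} := SMEq X

namespace SMEq

def map {X Y : Sig.{u}} (φ : X ⟶ Y) : ∀ {n m : ℕ}, SMEq X n m → SMEq Y n m
  | _, _, .parAssoc f g h => .parAssoc (φ.app f) (φ.app g) (φ.app h)
  | _, _, .epsPar f => .epsPar (φ.app f)
  | _, _, .parEps f => .parEps (φ.app f)
  | _, _, .symSym => .symSym
  | _, _, .interchange f g h i => .interchange (φ.app f) (φ.app g) (φ.app h) (φ.app i)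
  | _, _, .seqAssoc f g h => .seqAssoc (φ.app f) (φ.app g) (φ.app h)
  | _, _, .seqId f => .seqId (φ.app f)
  | _, _, .idSeq f => .idSeq (φ.app f)
  | _, _, .symOneNat f => .symOneNat (φ.app f)
  | _, _, .oneSymNat g => .oneSymNat (φ.app g)

open SMTerm

/-- Left-hand sides. -/
def lhs {X : Sig.{u}} : ∀ {n m : ℕ}, SMEq X n m → SMTerm X n m
  | _, _, .parAssoc f g h => (SMTermSig X).cast (Nat.add_assoc _ _ _) (Nat.add_assoc _ _ _)
      (SMTerm.par (SMTerm.par (var f) (var g)) (var h))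
  | _, _, .epsPar f => (SMTermSig X).cast (Nat.zero_add _) (Nat.zero_add _)
      (SMTerm.par SMTerm.eps (var f))
  | _, _, .parEps f => SMTerm.par (var f) SMTerm.eps
  | _, _, .symSym => SMTerm.seq SMTerm.sym SMTerm.sym
  | _, _, .interchange f g h i =>
      SMTerm.par (SMTerm.seq (var f) (var g)) (SMTerm.seq (var h) (var i))
  | _, _, .seqAssoc f g h => SMTerm.seq (SMTerm.seq (var f) (var g)) (var h)
  | _, _, @seqId _ _ m f => SMTerm.seq (var f) (idn X m)
  | _, _, @idSeq _ n _ f => SMTerm.seq (idn X n) (var f)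
  | _, _, @symOneNat _ n _ f => SMTerm.seq (symOne X n) (SMTerm.par (var f) SMTerm.id1)
  | _, _, @oneSymNat _ n _ g => SMTerm.seq (oneSym X n) (SMTerm.par SMTerm.id1 (var g))

/-- Right-hand sides. -/
def rhs {X : Sig.{u}} : ∀ {n m : ℕ}, SMEq X n m → SMTerm X n m
  | _, _, .parAssoc f g h => SMTerm.par (var f) (SMTerm.par (var g) (var h))
  | _, _, .epsPar f => var f
  | _, _, .parEps f => var f
  | _, _, .symSym => idn X 2
  | _, _, .interchange f g h i =>
      SMTerm.seq (SMTerm.par (var f) (var h)) (SMTerm.par (var g) (var i))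
  | _, _, .seqAssoc f g h => SMTerm.seq (var f) (SMTerm.seq (var g) (var h))
  | _, _, .seqId f => var f
  | _, _, .idSeq f => var f
  | _, _, @symOneNat _ _ m f => SMTerm.seq (SMTerm.par SMTerm.id1 (var f)) (symOne X m)
  | _, _, @oneSymNat _ _ m g => SMTerm.seq (SMTerm.par (var g) SMTerm.id1) (oneSym X m)

theorem map_idn {X Y : Sig.{u}} (φ : X ⟶ Y) (n : ℕ) :
    Sig.Hom.app (mapHom φ) (n := n) (m := n) (idn X n) = idn Y n := by
  induction n with
  | zero => rfl
  | succ n ih =>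
    change SMTerm.par (Sig.Hom.app (mapHom φ) (n := n) (m := n) (idn X n)) SMTerm.id1 = _
    rw [ih]; rfl

theorem map_symOne {X Y : Sig.{u}} (φ : X ⟶ Y) (n : ℕ) :
    Sig.Hom.app (mapHom φ) (n := 1 + n) (m := n + 1) (symOne X n) = symOne Y n := by
  induction n with
  | zero => rfl
  | succ n ih =>
    exact congrArg₂ (fun (s : SMTerm Y (1 + n) (n + 1)) (t : SMTerm Y n n) =>
      SMTerm.seq (SMTerm.par s .id1 : SMTerm Y (1 + n + 1) (n + 1 + 1))
        (SMTerm.par t .sym : SMTerm Y (n + 2) (n + 2))) ih (map_idn φ n)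

theorem map_oneSym {X Y : Sig.{u}} (φ : X ⟶ Y) (n : ℕ) :
    Sig.Hom.app (mapHom φ) (n := n + 1) (m := 1 + n) (oneSym X n) = oneSym Y n := by
  induction n with
  | zero => rfl
  | succ n ih =>
    exact congrArg₂ (fun (s : SMTerm Y (n + 1) (1 + n)) (t : SMTerm Y n n) =>
      SMTerm.seq (SMTerm.par t .sym : SMTerm Y (n + 2) (n + 2))
        (SMTerm.par s .id1 : SMTerm Y (n + 1 + 1) (1 + n + 1))) ih (map_idn φ n)

theorem lhs_map {X Y : Sig.{u}} (φ : X ⟶ Y) {n m : ℕ} (e : SMEq X n m) :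
    lhs (map φ e) = (mapHom φ).app (lhs e) := by
  cases e with
  | parAssoc f g h =>
    exact (Sig.app_cast (mapHom φ) (Nat.add_assoc _ _ _) (Nat.add_assoc _ _ _)
      (SMTerm.par (SMTerm.par (var f) (var g)) (var h))).symm
  | epsPar f =>
    exact (Sig.app_cast (mapHom φ) (Nat.zero_add _) (Nat.zero_add _)
      (SMTerm.par SMTerm.eps (var f))).symm
  | seqId f => exact congrArg (SMTerm.seq (var (φ.app f))) (map_idn φ _).symm
  | idSeq f => exact congrArg (fun t => SMTerm.seq t (var (φ.app f))) (map_idn φ _).symm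
  | symOneNat f =>
    exact congrArg (fun t => SMTerm.seq t (SMTerm.par (var (φ.app f)) SMTerm.id1))
      (map_symOne φ _).symm
  | oneSymNat g =>
    exact congrArg (fun t => SMTerm.seq t (SMTerm.par SMTerm.id1 (var (φ.app g))))
      (map_oneSym φ _).symm
  | _ => rfl

theorem rhs_map {X Y : Sig.{u}} (φ : X ⟶ Y) {n m : ℕ} (e : SMEq X n m) :
    rhs (map φ e) = (mapHom φ).app (rhs e) := by
  cases e with
  | symOneNat f =>
    exact congrArg (fun t => SMTerm.seq (SMTerm.par SMTerm.id1 (var (φ.app f))) t)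
      (map_symOne φ _).symm
  | oneSymNat g =>
    exact congrArg (fun t => SMTerm.seq (SMTerm.par (var (φ.app g)) SMTerm.id1) t)
      (map_oneSym φ _).symm
  | _ => rfl

end SMEq

/-- The functor of variables of the equations. -/
def SMEqFunctor : Sig.{u} ⥤ Sig.{u} where
  obj := SMEqSig
  map φ := ⟨SMEq.map φ⟩
  map_id X := by
    ext n m e
    change SMEq X n m at e
    cases e <;> rfl
  map_comp {X Y Z} f g := by
    ext n m e
    change SMEq X n m at e
    cases e <;> rfl

/-- The equations of symmetric strict monoidal categories, as `S_SM†`-equations. -/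
def SMEquations : MonadEquations SMMonad.{u} where
  A := SMEqFunctor
  l :=
    { app := fun _ => ⟨SMEq.lhs⟩
      naturality := fun X Y φ => by
        ext n m e
        exact SMEq.lhs_map φ e }
  r :=
    { app := fun _ => ⟨SMEq.rhs⟩
      naturality := fun X Y φ => by
        ext n m e
        exact SMEq.rhs_map φ e }

/-! ## The prop monad: the quotient of the term monad by the equations -/

/-- Structural congruence: the smallest congruence on terms containing all substitution instances
of the equations. -/
inductive SMCongr (X : Sig.{u}) : ∀ {n m : ℕ}, SMTerm X n m → SMTerm X n m → Prop
  | eqn {n m : ℕ} (e : SMEq (SMTermSig X) n m) :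
      SMCongr X ((SMTerm.joinHom X).app e.lhs) ((SMTerm.joinHom X).app e.rhs)
  | refl {n m : ℕ} (t : SMTerm X n m) : SMCongr X t t
  | symm {n m : ℕ} {s t : SMTerm X n m} : SMCongr X s t → SMCongr X t s
  | trans {n m : ℕ} {r s t : SMTerm X n m} : SMCongr X r s → SMCongr X s t → SMCongr X r t
  | seq {n k m : ℕ} {s s' : SMTerm X n k} {t t' : SMTerm X k m} :
      SMCongr X s s' → SMCongr X t t' → SMCongr X (.seq s t) (.seq s' t')
  | par {n m n' m' : ℕ} {s s' : SMTerm X n m} {t t' : SMTerm X n' m'} :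
      SMCongr X s s' → SMCongr X t t' → SMCongr X (.par s t) (.par s' t')

/-- String diagrams over `X`: terms up to structural congruence. -/
def Diagram (X : Sig.{u}) : Sig.{u} := fun n m => Quot (SMCongr X (n := n) (m := m))

namespace Diagram

open SMTerm

/-- The class of a term. -/
def proj (X : Sig.{u}) : SMTermSig X ⟶ Diagram X := ⟨fun t => Quot.mk _ t⟩

theorem proj_surjective (X : Sig.{u}) {n m : ℕ} (d : Diagram X n m) :
    ∃ t : SMTerm X n m, (proj X).app t = d := Quot.exists_rep d

/-- The operations of string diagrams. -/
def op {X : Sig.{u}} : ∀ {n m : ℕ}, SMOp (Diagram X) n m → Diagram X n m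
  | _, _, .seq x y => Quot.map₂ SMTerm.seq (fun _ _ _ h => .seq (.refl _) h)
      (fun _ _ _ h => .seq h (.refl _)) x y
  | _, _, .id1 => Quot.mk _ .id1
  | _, _, .par x y => Quot.map₂ SMTerm.par (fun _ _ _ h => .par (.refl _) h)
      (fun _ _ _ h => .par h (.refl _)) x y
  | _, _, .eps => Quot.mk _ .eps
  | _, _, .sym => Quot.mk _ .sym

def opHom (X : Sig.{u}) : SM.obj (Diagram X) ⟶ Diagram X := ⟨op⟩

theorem nodeHom_proj (X : Sig.{u}) : nodeHom X ≫ proj X = SM.map (proj X) ≫ opHom X := by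
  ext n m o
  change SMOp (SMTermSig X) n m at o
  cases o <;> rfl

/-- An `S_SM`-algebra satisfies the equations. -/
def Satisfies {Y : Sig.{u}} (a : SM.obj Y ⟶ Y) : Prop :=
  ∀ (n m : ℕ) (e : SMEq Y n m), fold (𝟙 Y) a e.lhs = fold (𝟙 Y) a e.rhs

theorem fold_congr {X Y : Sig.{u}} (f : X ⟶ Y) (a : SM.obj Y ⟶ Y) (ha : Satisfies a)
    {n m : ℕ} {s t : SMTerm X n m} (h : SMCongr X s t) : fold f a s = fold f a t := by
  induction h with
  | @eqn n m e =>
    have key : joinHom X ≫ foldHom f a = mapHom (foldHom f a) ≫ foldHom (𝟙 Y) a := by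
      rw [mapHom_foldHom, joinHom, foldHom_comp _ _ a _ (nodeHom_foldHom _ _),
        Category.comp_id, Category.id_comp]
    have key' : ∀ t : SMTerm (SMTermSig X) n m, fold f a ((joinHom X).app t) =
        fold (𝟙 Y) a ((mapHom (foldHom f a)).app t) := fun t =>
      congrArg (fun k : SMTermSig (SMTermSig X) ⟶ Y => k.app t) key
    rw [key', key', ← SMEq.lhs_map, ← SMEq.rhs_map]
    exact ha _ _ _
  | refl => rfl
  | symm _ ih => exact ih.symm
  | trans _ _ ih₁ ih₂ => exact ih₁.trans ih₂
  | seq _ _ ih₁ ih₂ =>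
    change a.app (SMOp.seq _ _) = a.app (SMOp.seq _ _)
    rw [ih₁, ih₂]
  | par _ _ ih₁ ih₂ =>
    change a.app (SMOp.par _ _) = a.app (SMOp.par _ _)
    rw [ih₁, ih₂]

/-- Evaluation of string diagrams in an `S_SM`-algebra satisfying the equations. -/
def lift {X Y : Sig.{u}} (f : X ⟶ Y) (a : SM.obj Y ⟶ Y) (ha : Satisfies a) : Diagram X ⟶ Y :=
  ⟨fun d => Quot.lift (fold f a) (fun _ _ h => fold_congr f a ha h) d⟩

theorem proj_lift {X Y : Sig.{u}} (f : X ⟶ Y) (a : SM.obj Y ⟶ Y) (ha : Satisfies a) :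
    proj X ≫ lift f a ha = foldHom f a := rfl

theorem proj_cancel {X Y : Sig.{u}} {f g : Diagram X ⟶ Y} (h : proj X ≫ f = proj X ≫ g) :
    f = g := by
  ext n m d
  obtain ⟨t, rfl⟩ := proj_surjective X d
  exact congrArg (fun k : SMTermSig X ⟶ Y => k.app t) h

theorem eq_surjective {X : Sig.{u}} {n m : ℕ} (e : SMEq (Diagram X) n m) :
    ∃ e' : SMEq (SMTermSig X) n m, SMEq.map (proj X) e' = e := by
  cases e with
  | parAssoc f g h =>
    obtain ⟨f, rfl⟩ := proj_surjective X f
    obtain ⟨g, rfl⟩ := proj_surjective X g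
    obtain ⟨h, rfl⟩ := proj_surjective X h
    exact ⟨.parAssoc f g h, rfl⟩
  | epsPar f => obtain ⟨f, rfl⟩ := proj_surjective X f; exact ⟨.epsPar f, rfl⟩
  | parEps f => obtain ⟨f, rfl⟩ := proj_surjective X f; exact ⟨.parEps f, rfl⟩
  | symSym => exact ⟨.symSym, rfl⟩
  | interchange f g h i =>
    obtain ⟨f, rfl⟩ := proj_surjective X f
    obtain ⟨g, rfl⟩ := proj_surjective X g
    obtain ⟨h, rfl⟩ := proj_surjective X h
    obtain ⟨i, rfl⟩ := proj_surjective X i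
    exact ⟨.interchange f g h i, rfl⟩
  | seqAssoc f g h =>
    obtain ⟨f, rfl⟩ := proj_surjective X f
    obtain ⟨g, rfl⟩ := proj_surjective X g
    obtain ⟨h, rfl⟩ := proj_surjective X h
    exact ⟨.seqAssoc f g h, rfl⟩
  | seqId f => obtain ⟨f, rfl⟩ := proj_surjective X f; exact ⟨.seqId f, rfl⟩
  | idSeq f => obtain ⟨f, rfl⟩ := proj_surjective X f; exact ⟨.idSeq f, rfl⟩
  | symOneNat f => obtain ⟨f, rfl⟩ := proj_surjective X f; exact ⟨.symOneNat f, rfl⟩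
  | oneSymNat f => obtain ⟨f, rfl⟩ := proj_surjective X f; exact ⟨.oneSymNat f, rfl⟩

theorem map_proj_foldHom (X : Sig.{u}) :
    mapHom (proj X) ≫ foldHom (𝟙 _) (opHom X) = joinHom X ≫ proj X := by
  rw [mapHom_foldHom, joinHom, foldHom_comp _ _ (opHom X) _ (nodeHom_proj X),
    Category.comp_id, Category.id_comp]

theorem satisfies_opHom (X : Sig.{u}) : Satisfies (opHom X) := by
  intro n m e
  obtain ⟨e, rfl⟩ := eq_surjective e
  have key : ∀ t : SMTerm (SMTermSig X) n m,
      fold (𝟙 _) (opHom X) ((mapHom (proj X)).app t) = (proj X).app ((joinHom X).app t) := fun t =>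
    congrArg (fun k : SMTermSig (SMTermSig X) ⟶ Diagram X => k.app t) (map_proj_foldHom X)
  rw [SMEq.lhs_map, SMEq.rhs_map, key, key]
  exact Quot.sound (.eqn e)

theorem opHom_lift {X Y : Sig.{u}} (f : X ⟶ Y) (a : SM.obj Y ⟶ Y) (ha : Satisfies a) :
    opHom X ≫ lift f a ha = SM.map (lift f a ha) ≫ a := by
  ext n m o
  change SMOp (Diagram X) n m at o
  cases o with
  | seq x y =>
    obtain ⟨x, rfl⟩ := proj_surjective X x
    obtain ⟨y, rfl⟩ := proj_surjective X y
    rfl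
  | par x y =>
    obtain ⟨x, rfl⟩ := proj_surjective X x
    obtain ⟨y, rfl⟩ := proj_surjective X y
    rfl
  | _ => rfl

/-- The inclusion of generators. -/
def unitHom (X : Sig.{u}) : X ⟶ Diagram X := varHom X ≫ proj X

/-- Renaming of generators. -/
def mapD {X Y : Sig.{u}} (f : X ⟶ Y) : Diagram X ⟶ Diagram Y :=
  lift (f ≫ unitHom Y) (opHom Y) (satisfies_opHom Y)

/-- Flattening of diagrams of diagrams. -/
def joinD (X : Sig.{u}) : Diagram (Diagram X) ⟶ Diagram X :=
  lift (𝟙 _) (opHom X) (satisfies_opHom X)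

theorem unitHom_lift {X Y : Sig.{u}} (f : X ⟶ Y) (a : SM.obj Y ⟶ Y) (ha : Satisfies a) :
    unitHom X ≫ lift f a ha = f := rfl

theorem lift_comp {X Y Z : Sig.{u}} (f : X ⟶ Y) (a : SM.obj Y ⟶ Y) (ha : Satisfies a)
    (b : SM.obj Z ⟶ Z) (hb : Satisfies b) (h : Y ⟶ Z) (hh : a ≫ h = SM.map h ≫ b) :
    lift f a ha ≫ h = lift (f ≫ h) b hb := by
  apply proj_cancel
  rw [← Category.assoc, proj_lift, proj_lift, foldHom_comp _ _ b _ hh]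

theorem mapD_lift {W X Y : Sig.{u}} (g : W ⟶ X) (f : X ⟶ Y) (a : SM.obj Y ⟶ Y)
    (ha : Satisfies a) : mapD g ≫ lift f a ha = lift (g ≫ f) a ha := by
  rw [mapD, lift_comp _ _ _ a ha _ (opHom_lift f a ha), Category.assoc, unitHom_lift]

theorem lift_unit (X : Sig.{u}) :
    lift (unitHom X) (opHom X) (satisfies_opHom X) = 𝟙 _ := by
  apply proj_cancel
  rw [proj_lift, Category.comp_id]
  symm
  exact foldHom_unique _ _ _ rfl (nodeHom_proj X)

theorem proj_mapD {X Y : Sig.{u}} (f : X ⟶ Y) : proj X ≫ mapD f = mapHom f ≫ proj Y := by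
  rw [mapD, proj_lift, mapHom, foldHom_comp _ _ (opHom Y) _ (nodeHom_proj Y), Category.assoc]
  rfl

end Diagram

open Diagram in
/-- The prop monad `S_PROP`. -/
def PropMonad : Monad Sig.{u} where
  obj := Diagram
  map := mapD
  map_id X := by rw [mapD, Category.id_comp, lift_unit]
  map_comp {X Y Z} f g := by
    change mapD (f ≫ g) = mapD f ≫ lift (g ≫ unitHom Z) (opHom Z) (satisfies_opHom Z)
    rw [mapD_lift, mapD]
    rfl
  η := { app := unitHom, naturality := fun _ _ _ => rfl }
  μ :=
    { app := joinD
      naturality := fun X Y f => by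
        change mapD (mapD f) ≫ joinD Y = joinD X ≫ mapD f
        rw [joinD, joinD, mapD_lift, Category.comp_id]
        refine Eq.symm ((lift_comp _ _ _ (opHom Y) (satisfies_opHom Y) (mapD f)
          (opHom_lift _ _ _)).trans ?_)
        congr 1 }
  assoc X := by
    change mapD (joinD X) ≫ joinD X = joinD (Diagram X) ≫ joinD X
    rw [joinD, joinD, mapD_lift,
      lift_comp _ _ _ (opHom X) (satisfies_opHom X) _ (opHom_lift _ _ _),
      Category.comp_id, Category.id_comp]
  left_unit X := rfl
  right_unit X := by
    change mapD (unitHom X) ≫ joinD X = 𝟙 _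
    rw [joinD, mapD_lift, Category.comp_id, lift_unit]

open SMTerm Diagram in
/-- The quotient monad morphism `q : S_SM† ⇒ S_PROP`. -/
def propProj : SMMonad.{u} ⟶ PropMonad.{u} where
  app := proj
  naturality _ _ f := (proj_mapD f).symm
  app_η _ := rfl
  app_μ X := by
    change joinHom X ≫ proj X = (mapHom (proj X) ≫ proj (Diagram X)) ≫ joinD X
    rw [Category.assoc, joinD, proj_lift, map_proj_foldHom]

/-! ## The behaviour functor -/

/-- The extension `P̄_κ` to signatures of the powerset functor bounded by `κ`: subsets of
cardinality at most `κ`. -/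
def boundedPow (κ : Cardinal.{u}) : Sig.{u} ⥤ Sig.{u} where
  obj X := fun n m => {U : Set (X n m) // #U ≤ κ}
  map f := ⟨fun U => ⟨f.app '' U.1, mk_image_le.trans U.2⟩⟩
  map_id X := by
    apply Sig.hom_ext
    intro n m U
    apply Subtype.ext
    exact Set.image_id (α := X n m) U.1
  map_comp f g := by
    apply Sig.hom_ext
    intro n m U
    apply Subtype.ext
    exact Set.image_comp (g.app (n := n) (m := m)) f.app U.1

/-- The functor `L ; Id ; L`, where `L` is the span of words over `A` with both legs the length:
an element of type `(n, m)` over `X` is a triple `(v, x, w)` with `|v| = n`, `x ∈ X(n, m)` and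
`|w| = m`. -/
def labelled (A : Type u) : Sig.{u} ⥤ Sig.{u} where
  obj X := fun n m => List.Vector A n × X n m × List.Vector A m
  map f := ⟨fun t => (t.1, f.app t.2.1, t.2.2)⟩

/-- The behaviour functor `F = P̄_κ(L ; Id ; L)`. -/
def Behaviour (A : Type u) (κ : Cardinal.{u}) : Sig.{u} ⥤ Sig.{u} := labelled A ⋙ boundedPow κ

/-- The set of transitions given by an element of `F X`. -/
def transitions {A : Type u} {κ : Cardinal.{u}} {X : Sig.{u}} {n m : ℕ}
    (U : (Behaviour A κ).obj X n m) : Set (List.Vector A n × X n m × List.Vector A m) := U.1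

/-! ## The GSOS specification of the symmetric monoidal operations -/

section GSOS

variable (A : Type u) (X : Sig.{u})

open SMTerm

/-- From `c -a/b→ c'` and `d -b/c→ d'` infer `c ; d -a/c→ c' ; d'`. -/
def seqRule {n k m : ℕ} (U : Set (List.Vector A n × X n k × List.Vector A k))
    (V : Set (List.Vector A k × X k m × List.Vector A m)) :
    Set (List.Vector A n × SMTerm X n m × List.Vector A m) :=
  {t | ∃ a b c c' d', (a, c', b) ∈ U ∧ (b, d', c) ∈ V ∧ t = (a, .seq (var c') (var d'), c)}

/-- `id₁ -k/k→ id₁`. -/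
def idRule : Set (List.Vector A 1 × SMTerm X 1 1 × List.Vector A 1) :=
  {t | ∃ k : A, t = (⟨[k], rfl⟩, .id1, ⟨[k], rfl⟩)}

/-- From `c -a₁/b₁→ c'` and `d -a₂/b₂→ d'` infer `c ⊗ d -a₁a₂/b₁b₂→ c' ⊗ d'`. -/
def parRule {n m n' m' : ℕ} (U : Set (List.Vector A n × X n m × List.Vector A m))
    (V : Set (List.Vector A n' × X n' m' × List.Vector A m')) :
    Set (List.Vector A (n + n') × SMTerm X (n + n') (m + m') × List.Vector A (m + m')) :=
  {t | ∃ a₁ b₁ a₂ b₂ c' d', (a₁, c', b₁) ∈ U ∧ (a₂, d', b₂) ∈ V ∧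
    t = (a₁ ++ a₂, .par (var c') (var d'), b₁ ++ b₂)}

/-- `ε -ε/ε→ ε`. -/
def epsRule : Set (List.Vector A 0 × SMTerm X 0 0 × List.Vector A 0) :=
  {(⟨[], rfl⟩, .eps, ⟨[], rfl⟩)}

/-- `σ -kl/lk→ σ`. -/
def symRule : Set (List.Vector A 2 × SMTerm X 2 2 × List.Vector A 2) :=
  {t | ∃ k l : A, t = (⟨[k, l], rfl⟩, .sym, ⟨[l, k], rfl⟩)}

variable {A X} {κ : Cardinal.{u}}

theorem mk_seqRule_le (hκ : ℵ₀ ≤ κ) {n k m : ℕ}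
    {U : Set (List.Vector A n × X n k × List.Vector A k)}
    {V : Set (List.Vector A k × X k m × List.Vector A m)} (hU : #U ≤ κ) (hV : #V ≤ κ) :
    #(seqRule A X U V) ≤ κ := by
  have hsub : seqRule A X U V ⊆ Set.range (fun p : U × V =>
      (p.1.1.1, SMTerm.seq (var p.1.1.2.1) (var p.2.1.2.1), p.2.1.2.2)) := by
    rintro t ⟨a, b, c, c', d', hu, hv, rfl⟩
    exact ⟨(⟨_, hu⟩, ⟨_, hv⟩), rfl⟩
  refine (mk_le_mk_of_subset hsub).trans (mk_range_le.trans ?_)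
  rw [mk_prod, lift_id, lift_id]
  exact (mul_le_mul' hU hV).trans (mul_eq_self hκ).le

theorem mk_parRule_le (hκ : ℵ₀ ≤ κ) {n m n' m' : ℕ}
    {U : Set (List.Vector A n × X n m × List.Vector A m)}
    {V : Set (List.Vector A n' × X n' m' × List.Vector A m')} (hU : #U ≤ κ) (hV : #V ≤ κ) :
    #(parRule A X U V) ≤ κ := by
  have hsub : parRule A X U V ⊆ Set.range (fun p : U × V =>
      (p.1.1.1 ++ p.2.1.1, SMTerm.par (var p.1.1.2.1) (var p.2.1.2.1),
        p.1.1.2.2 ++ p.2.1.2.2)) := by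
    rintro t ⟨a, b, c, d, c', d', hu, hv, rfl⟩
    exact ⟨(⟨_, hu⟩, ⟨_, hv⟩), rfl⟩
  refine (mk_le_mk_of_subset hsub).trans (mk_range_le.trans ?_)
  rw [mk_prod, lift_id, lift_id]
  exact (mul_le_mul' hU hV).trans (mul_eq_self hκ).le

theorem mk_idRule_le (hA : #A ≤ κ) : #(idRule A X) ≤ κ := by
  have hsub : idRule A X ⊆ Set.range (fun k : A =>
      ((⟨[k], rfl⟩, SMTerm.id1, ⟨[k], rfl⟩) :
        List.Vector A 1 × SMTerm X 1 1 × List.Vector A 1)) := by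
    rintro t ⟨k, rfl⟩
    exact ⟨k, rfl⟩
  exact (mk_le_mk_of_subset hsub).trans (mk_range_le.trans hA)

theorem mk_epsRule_le (hκ : ℵ₀ ≤ κ) : #(epsRule A X) ≤ κ := by
  rw [epsRule, mk_singleton]
  exact one_le_aleph0.trans hκ

theorem mk_symRule_le (hκ : ℵ₀ ≤ κ) (hA : #A ≤ κ) : #(symRule A X) ≤ κ := by
  have hsub : symRule A X ⊆ Set.range (fun p : A × A =>
      ((⟨[p.1, p.2], rfl⟩, SMTerm.sym, ⟨[p.2, p.1], rfl⟩) :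
        List.Vector A 2 × SMTerm X 2 2 × List.Vector A 2)) := by
    rintro t ⟨k, l, rfl⟩
    exact ⟨(k, l), rfl⟩
  refine (mk_le_mk_of_subset hsub).trans (mk_range_le.trans ?_)
  rw [← mul_def]
  exact (mul_le_mul' hA hA).trans (mul_eq_self hκ).le

/-- The copairing of the five rules. -/
def gsosApp (hκ : ℵ₀ ≤ κ) (hA : #A ≤ κ) : ∀ {n m : ℕ}, SMOp ((Behaviour A κ).obj X) n m →
    (Behaviour A κ).obj (SMTermSig X) n m
  | _, _, .seq U V => ⟨seqRule A X U.1 V.1, mk_seqRule_le hκ U.2 V.2⟩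
  | _, _, .id1 => ⟨idRule A X, mk_idRule_le hA⟩
  | _, _, .par U V => ⟨parRule A X U.1 V.1, mk_parRule_le hκ U.2 V.2⟩
  | _, _, .eps => ⟨epsRule A X, mk_epsRule_le hκ⟩
  | _, _, .sym => ⟨symRule A X, mk_symRule_le hκ hA⟩

end GSOS

/-- The GSOS specification `S_SM F ⇒ F S_SM†` obtained as the coproduct of the specifications
for sequential composition, identity, monoidal product, unit and symmetry. -/
def gsos (A : Type u) (κ : Cardinal.{u}) (hκ : ℵ₀ ≤ κ) (hA : #A ≤ κ) :
    Behaviour A κ ⋙ SM ⟶ SMMonad.toFunctor ⋙ Behaviour A κ where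
  app _ := ⟨gsosApp hκ hA⟩
  naturality X Y f := by
    ext n m o
    change SMOp ((Behaviour A κ).obj X) n m at o
    cases o with
    | seq U V =>
      apply Subtype.ext
      ext t
      constructor
      · rintro ⟨a, b, c, _, _, ⟨⟨a', c', b'⟩, hu, e⟩, ⟨⟨b'', d', c''⟩, hv, e'⟩, rfl⟩
        cases e; cases e'
        exact ⟨_, ⟨_, _, _, c', d', hu, hv, rfl⟩, rfl⟩
      · rintro ⟨_, ⟨a, b, c, c', d', hu, hv, rfl⟩, rfl⟩
        exact ⟨a, b, c, _, _, ⟨_, hu, rfl⟩, ⟨_, hv, rfl⟩, rfl⟩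
    | id1 =>
      apply Subtype.ext
      ext t
      constructor
      · rintro ⟨k, rfl⟩
        exact ⟨_, ⟨k, rfl⟩, rfl⟩
      · rintro ⟨_, ⟨k, rfl⟩, rfl⟩
        exact ⟨k, rfl⟩
    | par U V =>
      apply Subtype.ext
      ext t
      constructor
      · rintro ⟨a₁, b₁, a₂, b₂, _, _, ⟨⟨a', c', b'⟩, hu, e⟩, ⟨⟨b'', d', c''⟩, hv, e'⟩, rfl⟩
        cases e; cases e'
        exact ⟨_, ⟨_, _, _, _, c', d', hu, hv, rfl⟩, rfl⟩
      · rintro ⟨_, ⟨a₁, b₁, a₂, b₂, c', d', hu, hv, rfl⟩, rfl⟩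
        exact ⟨a₁, b₁, a₂, b₂, _, _, ⟨_, hu, rfl⟩, ⟨_, hv, rfl⟩, rfl⟩
    | eps =>
      apply Subtype.ext
      exact (Set.image_singleton (f := Sig.Hom.app ((labelled A).map (SMTerm.mapHom f))
        (n := 0) (m := 0)) (a := (⟨[], rfl⟩, SMTerm.eps, ⟨[], rfl⟩))).symm
    | sym =>
      apply Subtype.ext
      ext t
      constructor
      · rintro ⟨k, l, rfl⟩
        exact ⟨_, ⟨k, l, rfl⟩, rfl⟩
      · rintro ⟨_, ⟨k, l, rfl⟩, rfl⟩
        exact ⟨k, l, rfl⟩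

/-- The distributive law `d` of the free monad `S_SM†` is the one induced by the GSOS
specification `g`: on `S_SM`-nodes it is `S S†F X → S F S†X → F S†S†X → F S†X`. -/
def IsInducedBy {F : Sig.{u} ⥤ Sig.{u}} (d : DistributiveLaw SMMonad F)
    (g : F ⋙ SM ⟶ SMMonad.toFunctor ⋙ F) : Prop :=
  ∀ X : Sig.{u}, SMTerm.nodeHom (F.obj X) ≫ d.nat.app X =
    SM.map (d.nat.app X) ≫ g.app (SMMonad.obj X) ≫ F.map (SMMonad.μ.app X)

/-! ## Props from algebras of the prop monad, and bisimilarity -/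

open SMTerm Diagram in
/-- The prop structure `P` is the one underlying the `S_PROP`-algebra `a`: its operations are the
interpretations under `a` of the operations of the syntax. -/
structure PropStr.Realizes {X : Sig.{u}} (P : PropStr X) (a : PropMonad.obj X ⟶ X) : Prop where
  seq : ∀ {n k m : ℕ} (x : X n k) (y : X k m),
    P.seq x y = a.app ((proj X).app (SMTerm.seq (var x) (var y)))
  id_one : P.id 1 = a.app ((proj X).app SMTerm.id1)
  par : ∀ {n m n' m' : ℕ} (x : X n m) (y : X n' m'),
    P.par x y = a.app ((proj X).app (SMTerm.par (var x) (var y)))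
  id_zero : P.id 0 = a.app ((proj X).app SMTerm.eps)
  symm_one_one : P.symm 1 1 = a.app ((proj X).app SMTerm.sym)

/-- `R` is a bisimulation on the `F`-coalgebra `γ`. -/
def IsBisimulation {A : Type u} {κ : Cardinal.{u}} {X : Sig.{u}}
    (γ : X ⟶ (Behaviour A κ).obj X) (R : ∀ {n m : ℕ}, X n m → X n m → Prop) : Prop :=
  ∀ {n m : ℕ} (x y : X n m), R x y →
    (∀ v x' w, (v, x', w) ∈ transitions (γ.app x) → ∃ y', (v, y', w) ∈ transitions (γ.app y) ∧ R x' y') ∧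
    (∀ v y' w, (v, y', w) ∈ transitions (γ.app y) → ∃ x', (v, x', w) ∈ transitions (γ.app x) ∧ R x' y')

/-- Bisimilarity of states of an `F`-coalgebra. -/
def Bisimilar {A : Type u} {κ : Cardinal.{u}} {X : Sig.{u}} (γ : X ⟶ (Behaviour A κ).obj X)
    {n m : ℕ} (x y : X n m) : Prop :=
  ∃ R : ∀ {n m : ℕ}, X n m → X n m → Prop, IsBisimulation γ R ∧ R x y

/-- The semantics `⟦·⟧_β`: the unique coalgebra morphism from `(S_PROP(S), β♯)` to the final
`F`-coalgebra. -/
def semantics {A : Type u} {κ : Cardinal.{u}} (lam : DistributiveLaw PropMonad (Behaviour A κ))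
    {Ω : Endofunctor.Coalgebra (Behaviour A κ)} (hΩ : Limits.IsTerminal Ω) {S : Sig.{u}}
    (β : S ⟶ (Behaviour A κ).obj (PropMonad.obj S)) : PropMonad.obj S ⟶ Ω.V :=
  (hΩ.from ⟨PropMonad.obj S, lam.sharp β⟩).f

/-! The argument rests on two dual liftings. A distributive law of `T` over `F` lifts `T` to a monad
on `F`-coalgebras. A final coalgebra `Ω` is therefore a `T`-algebra through the only coalgebra
morphism `TΩ ⟶ Ω`, and the unit law, associativity, uniqueness of the algebra and the fact that
final maps are algebra morphisms each equate two coalgebra morphisms into `Ω`.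

A specification `S F ⇒ F S†` lifts `F` to `S_SM`-algebras (`liftAlgebra`). The induced law is
evaluation of terms in the lifting of the free algebra, and by fusion (`inducedHom_comp`) its
composite with `F q` is evaluation in the lifting of the algebra of diagrams. Hence, as soon as the
lifting takes models of the equations to models, the law preserves the equations and descends to the
quotient monad.

That condition, `satisfies_liftAlgebra`, is the combinatorial core. It holds because the equations
are linear: a variable occurs once on each side, so both sides derive their transitions from one
transition of each variable. The words agree by manipulating lists, and the states reached agree by
the same equation in `b`.

Three independent facts complete the proof. A model of the equations is a prop: the symmetries
`σ_{n,m}` are assembled from `σ_{1,m}`, and naturality against a single wire gives full naturality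
by induction (`propOfAlgebra`). Conversely, a prop is determined by its composition, product and
three constants, since the hexagon yields all other symmetries (`isPropHom_of_map`). The behaviour
functor acts on each fibre as a quotient of a polynomial functor, which gives a final coalgebra
(`exists_final`). Finally, bisimilarity is the kernel of the final map (`bisimilar_iff`), hence a
congruence because that map is a prop morphism. -/

/-! ### Bialgebras on final and free coalgebras -/

section FinalBialgebra

variable {C : Type v} [Category.{w} C] {T : Monad C} {F : C ⥤ C} (d : DistributiveLaw T F)

/-- The lifting of the functor `T` to `F`-coalgebras. -/
def DistributiveLaw.liftCoalgebra {X : C} (c : X ⟶ F.obj X) : T.obj X ⟶ F.obj (T.obj X) :=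
  T.map c ≫ d.nat.app X

variable {d}

/-- Naturality of the law makes the lifting a functor on coalgebras; its unit and multiplication
laws, in the next two lemmas, make `η` and `μ` coalgebra morphisms. -/
theorem DistributiveLaw.liftCoalgebra_map {X Y : C} {c : X ⟶ F.obj X} {c' : Y ⟶ F.obj Y}
    {h : X ⟶ Y} (hh : c ≫ F.map h = h ≫ c') :
    d.liftCoalgebra c ≫ F.map (T.map h) = T.map h ≫ d.liftCoalgebra c' := by
  have nat := d.nat.naturality h
  dsimp at nat
  simp only [liftCoalgebra, Category.assoc]
  rw [← nat, ← T.map_comp_assoc, hh, T.map_comp_assoc]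

theorem DistributiveLaw.liftCoalgebra_unit {X : C} (c : X ⟶ F.obj X) :
    c ≫ F.map (T.η.app X) = T.η.app X ≫ d.liftCoalgebra c := by
  have nat := T.η.naturality c
  dsimp at nat
  rw [liftCoalgebra, ← reassoc_of% nat, d.unit]

theorem DistributiveLaw.liftCoalgebra_mul {X : C} (c : X ⟶ F.obj X) :
    d.liftCoalgebra (d.liftCoalgebra c) ≫ F.map (T.μ.app X) =
      T.μ.app X ≫ d.liftCoalgebra c := by
  have nat := T.μ.naturality c
  dsimp at nat
  simp only [liftCoalgebra, Category.assoc, T.map_comp]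
  rw [← reassoc_of% nat, d.mul]

/-- The unique coalgebra morphism into a final coalgebra. -/
def finalMap {Ω : Endofunctor.Coalgebra F} (hΩ : Limits.IsTerminal Ω) {X : C}
    (c : X ⟶ F.obj X) : X ⟶ Ω.V :=
  (hΩ.from ⟨X, c⟩).f

theorem finalMap_comm {Ω : Endofunctor.Coalgebra F} (hΩ : Limits.IsTerminal Ω) {X : C}
    (c : X ⟶ F.obj X) : c ≫ F.map (finalMap hΩ c) = finalMap hΩ c ≫ Ω.str :=
  (hΩ.from ⟨X, c⟩).h

theorem final_hom_ext {Ω : Endofunctor.Coalgebra F} (hΩ : Limits.IsTerminal Ω) {X : C}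
    (c : X ⟶ F.obj X) {f g : X ⟶ Ω.V} (hf : c ≫ F.map f = f ≫ Ω.str)
    (hg : c ≫ F.map g = g ≫ Ω.str) : f = g :=
  congrArg Endofunctor.Coalgebra.Hom.f
    (hΩ.hom_ext (⟨f, hf⟩ : (⟨X, c⟩ : Endofunctor.Coalgebra F) ⟶ Ω) ⟨g, hg⟩)

theorem coalgebra_comp {X Y Z : C} {c : X ⟶ F.obj X} {c' : Y ⟶ F.obj Y} {c'' : Z ⟶ F.obj Z}
    {f : X ⟶ Y} {g : Y ⟶ Z} (hf : c ≫ F.map f = f ≫ c') (hg : c' ≫ F.map g = g ≫ c'') :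
    c ≫ F.map (f ≫ g) = (f ≫ g) ≫ c'' := by
  rw [F.map_comp, reassoc_of% hf, hg, Category.assoc]

variable (d) in
/-- The algebra structure of a final coalgebra. -/
def DistributiveLaw.finalAlgebra {Ω : Endofunctor.Coalgebra F} (hΩ : Limits.IsTerminal Ω) :
    T.obj Ω.V ⟶ Ω.V :=
  finalMap hΩ (d.liftCoalgebra Ω.str)

/-- Both sides of either algebra law are coalgebra morphisms into `Ω`, so finality identifies them.
Compatibility is the very statement that the algebra structure is a coalgebra morphism. -/
theorem DistributiveLaw.finalAlgebra_isBialgebra {Ω : Endofunctor.Coalgebra F}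
    (hΩ : Limits.IsTerminal Ω) : IsBialgebra d (d.finalAlgebra hΩ) Ω.str where
  unit := final_hom_ext hΩ Ω.str
    (coalgebra_comp (liftCoalgebra_unit _) (finalMap_comm hΩ _)) (by simp)
  assoc := final_hom_ext hΩ (d.liftCoalgebra (d.liftCoalgebra Ω.str))
    (coalgebra_comp (liftCoalgebra_mul _) (finalMap_comm hΩ _))
    (coalgebra_comp (liftCoalgebra_map (finalMap_comm hΩ _)) (finalMap_comm hΩ _))
  compat := by
    have := finalMap_comm hΩ (d.liftCoalgebra Ω.str)
    rwa [liftCoalgebra, Category.assoc] at this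

theorem IsBialgebra.comm {X : C} {a : T.obj X ⟶ X} {c : X ⟶ F.obj X} (h : IsBialgebra d a c) :
    d.liftCoalgebra c ≫ F.map a = a ≫ c := by
  rw [DistributiveLaw.liftCoalgebra, Category.assoc, h.compat]

theorem DistributiveLaw.finalAlgebra_unique {Ω : Endofunctor.Coalgebra F}
    (hΩ : Limits.IsTerminal Ω) {b : T.obj Ω.V ⟶ Ω.V} (hb : IsBialgebra d b Ω.str) :
    b = d.finalAlgebra hΩ :=
  final_hom_ext hΩ _ hb.comm (finalMap_comm hΩ _)

/-- Both composites are coalgebra morphisms from the lifted coalgebra on `T X` to `Ω`: on one side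
by functoriality of the lifting, on the other because compatibility makes `a` a coalgebra morphism.
-/
theorem DistributiveLaw.finalMap_algebra {Ω : Endofunctor.Coalgebra F}
    (hΩ : Limits.IsTerminal Ω) {X : C} {a : T.obj X ⟶ X} {c : X ⟶ F.obj X}
    (h : IsBialgebra d a c) :
    T.map (finalMap hΩ c) ≫ d.finalAlgebra hΩ = a ≫ finalMap hΩ c :=
  final_hom_ext hΩ (d.liftCoalgebra c)
    (coalgebra_comp (liftCoalgebra_map (finalMap_comm hΩ _)) (finalMap_comm hΩ _))
    (coalgebra_comp h.comm (finalMap_comm hΩ _))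

theorem DistributiveLaw.sharp_isBialgebra {X : C} (β : X ⟶ F.obj (T.obj X)) :
    IsBialgebra d (T.μ.app X) (d.sharp β) where
  unit := T.left_unit X
  assoc := (T.assoc X).symm
  compat := by
    have nat := T.μ.naturality β
    have nat' := d.nat.naturality (T.μ.app X)
    have assoc := T.assoc X
    dsimp at nat nat' assoc
    simp only [sharp, T.map_comp, Category.assoc]
    -- Pull `μ` in front of `T β`, trade it for two uses of the law, and merge the two
    -- multiplications that remain under `F` by associativity.
    rw [← reassoc_of% nat, reassoc_of% (d.mul (T.obj X)), ← F.map_comp, ← assoc, F.map_comp,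
      reassoc_of% nat']

end FinalBialgebra

/-! ### Distributive laws from a specification that respects the equations -/

section Specification

open SMTerm Diagram

/-- `Satisfies` speaks only of the identity valuation; an arbitrary valuation reduces to it because
the two sides of the equations are natural under renaming. -/
theorem fold_eq_of_satisfies {X Y : Sig.{u}} (f : X ⟶ Y) {b : SM.obj Y ⟶ Y} (hb : Satisfies b)
    {n m : ℕ} (e : SMEq X n m) : fold f b e.lhs = fold f b e.rhs := by
  have key : ∀ t : SMTerm X n m, fold f b t = fold (𝟙 Y) b ((mapHom f).app t) := fun t =>
    congrArg (fun k : SMTermSig X ⟶ Y => k.app t) (mapHom_foldHom f (𝟙 Y) b).symm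
  rw [key, key, ← SMEq.lhs_map, ← SMEq.rhs_map]
  exact hb _ _ _

variable {F : Sig.{u} ⥤ Sig.{u}} (g : F ⋙ SM ⟶ SMMonad.toFunctor ⋙ F)

/-- The component of a specification, with values in terms. -/
def ruleHom (Y : Sig.{u}) : SM.obj (F.obj Y) ⟶ F.obj (SMTermSig Y) := g.app Y

theorem ruleHom_naturality {Y Z : Sig.{u}} (h : Y ⟶ Z) :
    SM.map (F.map h) ≫ ruleHom g Z = ruleHom g Y ≫ F.map (mapHom h) :=
  g.naturality h

/-- The lifting of `F` to `S_SM`-algebras along a specification. -/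
def liftAlgebra {Y : Sig.{u}} (b : SM.obj Y ⟶ Y) : SM.obj (F.obj Y) ⟶ F.obj Y :=
  ruleHom g Y ≫ F.map (foldHom (𝟙 Y) b)

theorem liftAlgebra_map {Y Z : Sig.{u}} {b : SM.obj Y ⟶ Y} {c : SM.obj Z ⟶ Z} {h : Y ⟶ Z}
    (hh : b ≫ h = SM.map h ≫ c) :
    liftAlgebra g b ≫ F.map h = SM.map (F.map h) ≫ liftAlgebra g c := by
  rw [liftAlgebra, liftAlgebra, Category.assoc, ← Category.assoc (SM.map _),
    ruleHom_naturality, Category.assoc, ← F.map_comp, ← F.map_comp, foldHom_comp _ _ c h hh,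
    mapHom_foldHom, Category.id_comp, Category.comp_id]

/-- The component at `X` of the law induced by a specification. -/
def inducedHom (X : Sig.{u}) : SMTermSig (F.obj X) ⟶ F.obj (SMTermSig X) :=
  foldHom (F.map (varHom X)) (liftAlgebra g (nodeHom X))

/-- The fusion principle from which naturality, the multiplication law and the quotient are all read
off: the law followed by `F` of an evaluation is again an evaluation, now in the lifted algebra. -/
theorem inducedHom_comp {X Y : Sig.{u}} (f : X ⟶ Y) (b : SM.obj Y ⟶ Y) :
    inducedHom g X ≫ F.map (foldHom f b) = foldHom (F.map f) (liftAlgebra g b) := by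
  rw [inducedHom, foldHom_comp _ _ _ _ (liftAlgebra_map g (nodeHom_foldHom f b)), ← F.map_comp,
    varHom_foldHom]

theorem inducedHom_naturality {X Y : Sig.{u}} (f : X ⟶ Y) :
    mapHom (F.map f) ≫ inducedHom g Y = inducedHom g X ≫ F.map (mapHom f) := by
  rw [mapHom, mapHom, inducedHom_comp]
  change mapHom (F.map f) ≫ inducedHom g Y = _
  rw [inducedHom, mapHom_foldHom, F.map_comp]

theorem inducedHom_mul (X : Sig.{u}) : joinHom (F.obj X) ≫ inducedHom g X =
    mapHom (inducedHom g X) ≫ inducedHom g (SMTermSig X) ≫ F.map (joinHom X) := by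
  have h := inducedHom_comp g (𝟙 (SMTermSig X)) (nodeHom X)
  rw [joinHom, joinHom, h, mapHom_foldHom, F.map_id, Category.comp_id]
  have h' := foldHom_comp (𝟙 _) (nodeHom (F.obj X)) (liftAlgebra g (nodeHom X)) (inducedHom g X)
    (nodeHom_foldHom _ _)
  rw [h', Category.id_comp]

/-- The distributive law of the free monad induced by a specification. -/
def inducedLaw : DistributiveLaw SMMonad F where
  nat :=
    { app := inducedHom g
      naturality := fun _ _ f => inducedHom_naturality g f }
  unit _ := rfl
  mul X := inducedHom_mul g X

theorem inducedLaw_isInducedBy : IsInducedBy (inducedLaw g) g :=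
  fun _ => nodeHom_foldHom _ _

/-- The unit law fixes such a law on variables and the specification fixes it on nodes, so the
freeness of terms determines it. -/
theorem isInducedBy_unique {d : DistributiveLaw SMMonad F} (hd : IsInducedBy d g) :
    d = inducedLaw g := by
  apply DistributiveLaw.ext
  apply NatTrans.ext
  funext X
  exact foldHom_unique _ _ _ (d.unit X) (hd X)

variable (hg : ∀ (Y : Sig.{u}) (b : SM.obj Y ⟶ Y), Satisfies b → Satisfies (liftAlgebra g b))

/-- The projection `q` is itself the evaluation of terms in the algebra of diagrams, so fusion
applies to it. -/
theorem inducedHom_proj (X : Sig.{u}) : inducedHom g X ≫ F.map (proj X) =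
    foldHom (F.map (unitHom X)) (liftAlgebra g (opHom X)) :=
  inducedHom_comp g (unitHom X) (opHom X) ▸ by
    rw [foldHom_unique (unitHom X) (opHom X) (proj X) rfl (nodeHom_proj X)]

-- The algebra of diagrams is a model, hence by `hg` so is its lifting; by `inducedHom_proj` the
-- composite with `F q` evaluates both sides there.
include hg in
theorem inducedLaw_preserves : (inducedLaw g).Preserves SMEquations propProj := by
  intro X
  have h := inducedHom_proj g X
  apply Sig.hom_ext
  intro n m e
  have key : ∀ t : SMTerm (F.obj X) n m, (inducedHom g X ≫ F.map (proj X)).app t =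
      fold (F.map (unitHom X)) (liftAlgebra g (opHom X)) t := fun t =>
    congrArg (fun k : SMTermSig (F.obj X) ⟶ F.obj (Diagram X) => k.app t) h
  exact (key _).trans ((fold_eq_of_satisfies _ (hg _ _ (satisfies_opHom X)) e).trans (key _).symm)

/-- The component at `X` of the quotient law. -/
def quotientHom (X : Sig.{u}) : Diagram (F.obj X) ⟶ F.obj (Diagram X) :=
  lift (F.map (unitHom X)) (liftAlgebra g (opHom X)) (hg _ _ (satisfies_opHom X))

theorem quotientHom_comp {X Y : Sig.{u}} (f : X ⟶ Y) (b : SM.obj Y ⟶ Y) (hb : Satisfies b) :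
    quotientHom g hg X ≫ F.map (lift f b hb) = lift (F.map f) (liftAlgebra g b) (hg _ _ hb) := by
  have h := lift_comp (F.map (unitHom X)) _ (hg _ _ (satisfies_opHom X)) _ (hg _ _ hb) _
    (liftAlgebra_map g (opHom_lift f b hb))
  rw [quotientHom, h]
  congr 1
  rw [← F.map_comp, unitHom_lift]

theorem quotientHom_naturality {X Y : Sig.{u}} (f : X ⟶ Y) :
    mapD (F.map f) ≫ quotientHom g hg Y = quotientHom g hg X ≫ F.map (mapD f) := by
  have h : quotientHom g hg X ≫ F.map (mapD f) = _ := quotientHom_comp g hg _ _ _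
  rw [h, quotientHom, mapD_lift]
  congr 1
  rw [F.map_comp]

theorem quotientHom_mul (X : Sig.{u}) : joinD (F.obj X) ≫ quotientHom g hg X =
    mapD (quotientHom g hg X) ≫ quotientHom g hg (Diagram X) ≫ F.map (joinD X) := by
  have h : quotientHom g hg (Diagram X) ≫ F.map (joinD X) = _ := quotientHom_comp g hg _ _ _
  have h' := lift_comp (𝟙 _) (opHom (F.obj X)) (satisfies_opHom _) _
    (hg _ _ (satisfies_opHom X)) (quotientHom g hg X) (opHom_lift _ _ _)
  rw [h, mapD_lift, joinD, h']
  congr 1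
  rw [F.map_id, Category.comp_id, Category.id_comp]

/-- The distributive law of the prop monad induced by a specification that preserves the
equations. -/
def quotientLaw : DistributiveLaw PropMonad F where
  nat :=
    { app := quotientHom g hg
      naturality := fun _ _ f => quotientHom_naturality g hg f }
  unit _ := rfl
  mul X := quotientHom_mul g hg X

theorem quotientLaw_isQuotient : (inducedLaw g).IsQuotient (quotientLaw g hg) propProj :=
  fun X => (inducedHom_proj g X).symm

theorem isQuotient_unique {d : DistributiveLaw PropMonad F}
    (hd : (inducedLaw g).IsQuotient d propProj) : d = quotientLaw g hg := by
  apply DistributiveLaw.ext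
  apply NatTrans.ext
  funext X
  exact proj_cancel ((hd X).trans (quotientLaw_isQuotient g hg X).symm)

/-- The `S_SM`-algebra underlying an `S_PROP`-algebra. -/
def underlyingAlgebra {X : Sig.{u}} (a : Diagram X ⟶ X) : SM.obj X ⟶ X :=
  SM.map (unitHom X) ≫ opHom X ≫ a

/-- Says that `a` is an `S_SM`-algebra morphism out of the diagrams. An operation on diagrams is an
operation on their units followed by flattening, and associativity lets `mapD a` replace the
flattening. -/
theorem opHom_algebra {X : Sig.{u}} {a : Diagram X ⟶ X}
    (assoc : joinD X ≫ a = mapD a ≫ a) :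
    opHom X ≫ a = SM.map a ≫ underlyingAlgebra a := by
  have e : opHom (Diagram X) ≫ mapD a = SM.map (mapD a) ≫ opHom X := opHom_lift _ _ _
  have e' : opHom (Diagram X) ≫ joinD X = SM.map (joinD X) ≫ opHom X := opHom_lift _ _ _
  have nat : a ≫ unitHom X = unitHom (Diagram X) ≫ mapD a := rfl
  have unit' : unitHom (Diagram X) ≫ joinD X = 𝟙 _ := rfl
  symm
  calc SM.map a ≫ SM.map (unitHom X) ≫ opHom X ≫ a
      = SM.map (unitHom (Diagram X)) ≫ (SM.map (mapD a) ≫ opHom X) ≫ a := by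
        rw [← SM.map_comp_assoc, nat, SM.map_comp_assoc, Category.assoc]
    _ = SM.map (unitHom (Diagram X)) ≫ (SM.map (joinD X) ≫ opHom X) ≫ a := by
        rw [← e, ← e', Category.assoc, Category.assoc, assoc]
    _ = opHom X ≫ a := by
        rw [Category.assoc, ← SM.map_comp_assoc, unit', SM.map_id, Category.id_comp]

/-- Equations pass to the target of a split algebra morphism: values in `Y` are moved to `X` along
`s`, which need not itself respect the operations. -/
theorem satisfies_of_section {X Y : Sig.{u}} {b : SM.obj X ⟶ X} {c : SM.obj Y ⟶ Y}
    (hb : Satisfies b) {h : X ⟶ Y} (s : Y ⟶ X) (hs : s ≫ h = 𝟙 Y)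
    (hh : b ≫ h = SM.map h ≫ c) : Satisfies c := by
  intro n m e
  have key : ∀ t : SMTerm Y n m, fold (𝟙 Y) c t = h.app (fold s b t) := fun t =>
    congrArg (fun k : SMTermSig Y ⟶ Y => k.app t)
      ((congrArg (fun k => foldHom k c) hs).symm.trans (foldHom_comp s b c h hh).symm)
  rw [key, key, fold_eq_of_satisfies s hb]

theorem satisfies_underlyingAlgebra {X : Sig.{u}} {a : Diagram X ⟶ X}
    (unit : unitHom X ≫ a = 𝟙 X) (assoc : joinD X ≫ a = mapD a ≫ a) :
    Satisfies (underlyingAlgebra a) :=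
  satisfies_of_section (satisfies_opHom X) (unitHom X) unit (opHom_algebra assoc)

end Specification

/-! ### Words of fixed length -/

section Words

variable {A : Type u}

theorem vector_exists_append {n m : ℕ} (v : List.Vector A (n + m)) :
    ∃ (a : List.Vector A n) (b : List.Vector A m), v = a ++ b :=
  ⟨⟨v.1.take n, by simp⟩, ⟨v.1.drop n, by simp⟩, Subtype.ext (List.take_append_drop n v.1).symm⟩

theorem vector_append_inj {n m : ℕ} {a a' : List.Vector A n} {b b' : List.Vector A m}
    (h : a ++ b = a' ++ b') : a = a' ∧ b = b' := by
  have h' : a.1 ++ b.1 = a'.1 ++ b'.1 := congrArg Subtype.val h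
  obtain ⟨h₁, h₂⟩ := List.append_inj h' (a.2.trans a'.2.symm)
  exact ⟨Subtype.ext h₁, Subtype.ext h₂⟩

theorem vector_append_val {n m : ℕ} (a : List.Vector A n) (b : List.Vector A m) :
    (a ++ b).1 = a.1 ++ b.1 := rfl

/-- The word of length one on a letter. -/
abbrev letter (k : A) : List.Vector A 1 := ⟨[k], rfl⟩

theorem vector_one (v : List.Vector A 1) : ∃ k : A, v = ⟨[k], rfl⟩ := by
  obtain ⟨l, hl⟩ := v
  obtain ⟨k, rfl⟩ := List.length_eq_one_iff.1 hl
  exact ⟨k, rfl⟩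

end Words

/-! ### Transitions of the lifted operations -/

section Transitions

open SMTerm Diagram

variable {A : Type u} {κ : Cardinal.{u}} {hκ : ℵ₀ ≤ κ} {hA : #A ≤ κ} {Y : Sig.{u}}

/-- Words are compared as underlying lists, since after transport the two sides have vectors of
different types. -/
theorem mem_cast {n m n' m' : ℕ} (hn : n = n') (hm : m = m') (U : (Behaviour A κ).obj Y n m)
    {v : List.Vector A n'} {x : Y n' m'} {w : List.Vector A m'} :
    (v, x, w) ∈ transitions (((Behaviour A κ).obj Y).cast hn hm U) ↔
      ∃ v' x' w', (v', x', w') ∈ transitions U ∧ v.1 = v'.1 ∧ x = Y.cast hn hm x' ∧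
        w.1 = w'.1 := by
  subst hn hm
  constructor
  · exact fun h => ⟨v, x, w, h, rfl, rfl, rfl⟩
  · rintro ⟨v', x', w', h, hv, rfl, hw⟩
    cases Subtype.ext hv
    cases Subtype.ext hw
    exact h

variable {b : SM.obj Y ⟶ Y}

/-- A rule ends in one operation applied to the successors, and evaluating that term in `b` turns
the rule into this description. After this and the next four lemmas the rules are not unfolded
again. -/
theorem mem_liftAlgebra_seq {n k m : ℕ} {U : (Behaviour A κ).obj Y n k}
    {V : (Behaviour A κ).obj Y k m} {v : List.Vector A n} {x : Y n m} {w : List.Vector A m} :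
    (v, x, w) ∈ transitions ((liftAlgebra (gsos A κ hκ hA) b).app (SMOp.seq U V)) ↔
      ∃ c' z d', (v, c', z) ∈ transitions U ∧ (z, d', w) ∈ transitions V ∧
        x = b.app (SMOp.seq c' d') := by
  constructor
  · rintro ⟨_, ⟨a, z, c, c', d', hu, hv, rfl⟩, h⟩
    cases h
    exact ⟨c', z, d', hu, hv, rfl⟩
  · rintro ⟨c', z, d', hu, hv, rfl⟩
    exact ⟨_, ⟨_, _, _, c', d', hu, hv, rfl⟩, rfl⟩

theorem mem_liftAlgebra_par {n m n' m' : ℕ} {U : (Behaviour A κ).obj Y n m}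
    {V : (Behaviour A κ).obj Y n' m'} {v : List.Vector A (n + n')} {x : Y (n + n') (m + m')}
    {w : List.Vector A (m + m')} :
    (v, x, w) ∈ transitions ((liftAlgebra (gsos A κ hκ hA) b).app (SMOp.par U V)) ↔
      ∃ v₁ c' w₁ v₂ d' w₂, (v₁, c', w₁) ∈ transitions U ∧ (v₂, d', w₂) ∈ transitions V ∧
        v = v₁ ++ v₂ ∧ x = b.app (SMOp.par c' d') ∧ w = w₁ ++ w₂ := by
  constructor
  · rintro ⟨_, ⟨a₁, b₁, a₂, b₂, c', d', hu, hv, rfl⟩, h⟩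
    cases h
    exact ⟨_, _, _, _, _, _, hu, hv, rfl, rfl, rfl⟩
  · rintro ⟨v₁, c', w₁, v₂, d', w₂, hu, hv, rfl, rfl, rfl⟩
    exact ⟨_, ⟨_, _, _, _, c', d', hu, hv, rfl⟩, rfl⟩

theorem mem_liftAlgebra_id {v : List.Vector A 1} {x : Y 1 1} {w : List.Vector A 1} :
    (v, x, w) ∈ transitions ((liftAlgebra (gsos A κ hκ hA) b).app SMOp.id1) ↔
      x = b.app SMOp.id1 ∧ v = w := by
  constructor
  · rintro ⟨_, ⟨k, rfl⟩, h⟩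
    cases h
    exact ⟨rfl, rfl⟩
  · rintro ⟨rfl, rfl⟩
    obtain ⟨k, rfl⟩ := vector_one v
    exact ⟨_, ⟨k, rfl⟩, rfl⟩

theorem mem_liftAlgebra_eps {v : List.Vector A 0} {x : Y 0 0} {w : List.Vector A 0} :
    (v, x, w) ∈ transitions ((liftAlgebra (gsos A κ hκ hA) b).app SMOp.eps) ↔
      x = b.app SMOp.eps := by
  constructor
  · rintro ⟨_, h', h⟩
    cases h'
    cases h
    rfl
  · rintro rfl
    refine ⟨_, rfl, ?_⟩
    cases v.eq_nil
    cases w.eq_nil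
    rfl

theorem mem_liftAlgebra_sym {v : List.Vector A 2} {x : Y 2 2} {w : List.Vector A 2} :
    (v, x, w) ∈ transitions ((liftAlgebra (gsos A κ hκ hA) b).app SMOp.sym) ↔
      x = b.app SMOp.sym ∧ ∃ k l : A, v.1 = [k, l] ∧ w.1 = [l, k] := by
  constructor
  · rintro ⟨_, ⟨k, l, rfl⟩, h⟩
    cases h
    exact ⟨rfl, k, l, rfl, rfl⟩
  · rintro ⟨rfl, k, l, hv, hw⟩
    refine ⟨_, ⟨k, l, rfl⟩, ?_⟩
    obtain ⟨v, _⟩ := v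
    obtain ⟨w, _⟩ := w
    cases hv
    cases hw
    rfl

variable (hκ hA b) in
/-- Evaluation of terms in the lifted algebra. -/
abbrev liftEval {n m : ℕ} (t : SMTerm ((Behaviour A κ).obj Y) n m) :
    (Behaviour A κ).obj Y n m :=
  fold (𝟙 _) (liftAlgebra (gsos A κ hκ hA) b) t

theorem mem_liftEval_idn {n : ℕ} {v : List.Vector A n} {x : Y n n} {w : List.Vector A n} :
    (v, x, w) ∈ transitions (liftEval hκ hA b (idn _ n)) ↔
      x = fold (𝟙 Y) b (idn Y n) ∧ v = w := by
  induction n with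
  | zero =>
    refine mem_liftAlgebra_eps.trans ⟨fun h => ⟨h, ?_⟩, fun h => h.1⟩
    rw [v.eq_nil, w.eq_nil]
  | succ n ih =>
    refine mem_liftAlgebra_par.trans ?_
    constructor
    · rintro ⟨v₁, c', w₁, v₂, d', w₂, h₁, h₂, rfl, rfl, rfl⟩
      obtain ⟨rfl, rfl⟩ := ih.1 h₁
      obtain ⟨rfl, rfl⟩ := mem_liftAlgebra_id.1 h₂
      exact ⟨rfl, rfl⟩
    · rintro ⟨rfl, rfl⟩
      obtain ⟨v₁, v₂, rfl⟩ := vector_exists_append v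
      exact ⟨v₁, _, v₁, v₂, _, v₂, ih.2 ⟨rfl, rfl⟩, mem_liftAlgebra_id.2 ⟨rfl, rfl⟩,
        rfl, rfl, rfl⟩

theorem mem_liftEval_symOne {n : ℕ} {v : List.Vector A (1 + n)} {x : Y (1 + n) (n + 1)}
    {w : List.Vector A (n + 1)} :
    (v, x, w) ∈ transitions (liftEval hκ hA b (symOne _ n)) ↔
      x = fold (𝟙 Y) b (symOne Y n) ∧ ∃ k l, v.1 = k :: l ∧ w.1 = l ++ [k] := by
  induction n with
  | zero =>
    refine mem_liftAlgebra_id.trans ?_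
    constructor
    · rintro ⟨rfl, rfl⟩
      obtain ⟨k, rfl⟩ := vector_one v
      exact ⟨rfl, k, [], rfl, rfl⟩
    · rintro ⟨rfl, k, l, hv, hw⟩
      refine ⟨rfl, ?_⟩
      have hl : l = [] := by
        have := v.2
        rw [hv] at this
        simpa using this
      subst hl
      exact Subtype.ext (hv.trans hw.symm)
  | succ n ih =>
    refine mem_liftAlgebra_seq.trans ?_
    constructor
    · rintro ⟨c', z, d', h₁, h₂, rfl⟩
      obtain ⟨v₁, c₁, w₁, v₂, d₁, w₂, h₃, h₄, rfl, rfl, rfl⟩ := mem_liftAlgebra_par.1 h₁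
      obtain ⟨v₃, c₂, w₃, v₄, d₂, w₄, h₅, h₆, hz, rfl, rfl⟩ := mem_liftAlgebra_par.1 h₂
      obtain ⟨rfl, k, l, hv, hw⟩ := ih.1 h₃
      obtain ⟨rfl, rfl⟩ := mem_liftAlgebra_id.1 h₄
      obtain ⟨rfl, rfl⟩ := mem_liftEval_idn.1 h₅
      obtain ⟨rfl, p, q, hp, hq⟩ := mem_liftAlgebra_sym.1 h₆
      refine ⟨rfl, k, l ++ v₂.1, by rw [vector_append_val, hv]; rfl, ?_⟩
      have hz' : w₁.1 ++ v₂.1 = v₃.1 ++ v₄.1 := congrArg Subtype.val hz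
      obtain ⟨r, rfl⟩ := vector_one v₂
      rw [hw, hp, List.append_assoc] at hz'
      -- The middle word is `l k r` after the first stage and ends in `p q` before the second;
      -- comparing the last two letters gives `p = k` and `q = r`.
      obtain ⟨rfl, e⟩ := List.append_inj' hz' rfl
      cases e
      rw [vector_append_val, hq, List.append_assoc]
      rfl
    · rintro ⟨rfl, k, l, hv, hw⟩
      have hl : l.length = n + 1 := by
        have := v.2
        rw [hv, List.length_cons] at this
        omega
      obtain ⟨u, s, rfl, hs⟩ : ∃ u s, l = u ++ s ∧ s.length = 1 :=
        ⟨l.take n, l.drop n, (List.take_append_drop n l).symm, by simp [hl]⟩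
      obtain ⟨r, rfl⟩ := List.length_eq_one_iff.1 hs
      have hu : u.length = n := by simpa using hl
      -- On the input `k u r` the first stage carries `k` past `u`, giving `u k r`, and the second
      -- exchanges `k` and `r`.
      refine ⟨_, ⟨u ++ [k] ++ [r], by simp [hu]⟩, _,
        mem_liftAlgebra_par.2 ⟨⟨k :: u, by simp [hu]; omega⟩, _, ⟨u ++ [k], by simp [hu]⟩,
          ⟨[r], rfl⟩, _, ⟨[r], rfl⟩, ih.2 ⟨rfl, k, u, rfl, rfl⟩,
          mem_liftAlgebra_id.2 ⟨rfl, rfl⟩, Subtype.ext hv, rfl, rfl⟩,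
        mem_liftAlgebra_par.2 ⟨⟨u, hu⟩, _, ⟨u, hu⟩, ⟨[k, r], rfl⟩, _, ⟨[r, k], rfl⟩,
          mem_liftEval_idn.2 ⟨rfl, rfl⟩, mem_liftAlgebra_sym.2 ⟨rfl, k, r, rfl, rfl⟩,
          Subtype.ext (List.append_assoc _ _ _), rfl,
          Subtype.ext (hw.trans (List.append_assoc _ _ _))⟩, rfl⟩

theorem mem_liftEval_oneSym {n : ℕ} {v : List.Vector A (n + 1)} {x : Y (n + 1) (1 + n)}
    {w : List.Vector A (1 + n)} :
    (v, x, w) ∈ transitions (liftEval hκ hA b (oneSym _ n)) ↔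
      x = fold (𝟙 Y) b (oneSym Y n) ∧ ∃ k l, v.1 = l ++ [k] ∧ w.1 = k :: l := by
  induction n with
  | zero =>
    refine mem_liftAlgebra_id.trans ?_
    constructor
    · rintro ⟨rfl, rfl⟩
      obtain ⟨k, rfl⟩ := vector_one v
      exact ⟨rfl, k, [], rfl, rfl⟩
    · rintro ⟨rfl, k, l, hv, hw⟩
      refine ⟨rfl, ?_⟩
      have hl : l = [] := by
        have := w.2
        rw [hw] at this
        simpa using this
      subst hl
      exact Subtype.ext (hv.trans hw.symm)
  | succ n ih =>
    refine mem_liftAlgebra_seq.trans ?_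
    constructor
    · rintro ⟨c', z, d', h₁, h₂, rfl⟩
      obtain ⟨v₃, c₂, w₃, v₄, d₂, w₄, h₅, h₆, rfl, rfl, rfl⟩ := mem_liftAlgebra_par.1 h₁
      obtain ⟨v₁, c₁, w₁, v₂, d₁, w₂, h₃, h₄, hz, rfl, rfl⟩ := mem_liftAlgebra_par.1 h₂
      obtain ⟨rfl, k, l, hv, hw⟩ := ih.1 h₃
      obtain ⟨rfl, rfl⟩ := mem_liftAlgebra_id.1 h₄
      obtain ⟨rfl, rfl⟩ := mem_liftEval_idn.1 h₅
      obtain ⟨rfl, p, q, hp, hq⟩ := mem_liftAlgebra_sym.1 h₆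
      refine ⟨rfl, k, l ++ v₂.1, ?_, by rw [vector_append_val, hw]; rfl⟩
      have hz' : v₃.1 ++ w₄.1 = v₁.1 ++ v₂.1 := congrArg Subtype.val hz
      obtain ⟨r, rfl⟩ := vector_one v₂
      rw [hv, hq, List.append_assoc] at hz'
      obtain ⟨e', e⟩ := List.append_inj' hz' rfl
      cases e
      rw [vector_append_val, hp, List.append_assoc, e']
      rfl
    · rintro ⟨rfl, k, l, hv, hw⟩
      have hl : l.length = n + 1 := by
        have := w.2
        rw [hw, List.length_cons] at this
        omega
      obtain ⟨u, s, rfl, hs⟩ : ∃ u s, l = u ++ s ∧ s.length = 1 :=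
        ⟨l.take n, l.drop n, (List.take_append_drop n l).symm, by simp [hl]⟩
      obtain ⟨r, rfl⟩ := List.length_eq_one_iff.1 hs
      have hu : u.length = n := by simpa using hl
      -- On the input `u r k` the first stage exchanges the last two letters, giving `u k r`, and
      -- the second carries `k` past `u`.
      refine ⟨_, ⟨u ++ [k, r], by simp [hu]⟩, _,
        mem_liftAlgebra_par.2 ⟨⟨u, hu⟩, _, ⟨u, hu⟩, ⟨[r, k], rfl⟩, _, ⟨[k, r], rfl⟩,
          mem_liftEval_idn.2 ⟨rfl, rfl⟩, mem_liftAlgebra_sym.2 ⟨rfl, r, k, rfl, rfl⟩,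
          Subtype.ext (hv.trans (List.append_assoc _ _ _)), rfl, rfl⟩,
        mem_liftAlgebra_par.2 ⟨⟨u ++ [k], by simp [hu]⟩, _, ⟨k :: u, by simp [hu]; omega⟩,
          ⟨[r], rfl⟩, _, ⟨[r], rfl⟩, ih.2 ⟨rfl, k, u, rfl, rfl⟩,
          mem_liftAlgebra_id.2 ⟨rfl, rfl⟩, Subtype.ext (List.append_assoc u [k] [r]).symm, rfl,
          Subtype.ext hw⟩, rfl⟩

theorem behaviour_ext {n m : ℕ} {U V : (Behaviour A κ).obj Y n m}
    (h : ∀ v x w, (v, x, w) ∈ transitions U ↔ (v, x, w) ∈ transitions V) : U = V := by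
  apply Subtype.ext
  ext ⟨v, x, w⟩
  exact h v x w

end Transitions

/-! ### The lifted algebra satisfies each equation -/

section Preservation

open SMTerm Diagram

variable {A : Type u} {κ : Cardinal.{u}} {hκ : ℵ₀ ≤ κ} {hA : #A ≤ κ} {Y : Sig.{u}}
  {b : SM.obj Y ⟶ Y}

theorem fold_cast {X : Sig.{u}} (f : X ⟶ Y) {n m n' m' : ℕ} (hn : n = n') (hm : m = m')
    (t : SMTermSig X n m) :
    fold f b ((SMTermSig X).cast hn hm t) = Y.cast hn hm (fold f b t) :=
  Sig.app_cast (foldHom f b) hn hm t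

theorem Diagram.Satisfies.parAssoc (hb : Satisfies b) {a a' a'' c c' c'' : ℕ} (f : Y a c)
    (g : Y a' c') (h : Y a'' c'') :
    Y.cast (Nat.add_assoc a a' a'') (Nat.add_assoc c c' c'')
      (b.app (SMOp.par (b.app (SMOp.par f g)) h)) = b.app (SMOp.par f (b.app (SMOp.par g h))) :=
  (fold_cast (𝟙 Y) (Nat.add_assoc _ _ _) (Nat.add_assoc _ _ _)
    (SMTerm.par (SMTerm.par (var f) (var g)) (var h))).symm.trans (hb _ _ (.parAssoc f g h))

theorem Diagram.Satisfies.epsPar (hb : Satisfies b) {n m : ℕ} (f : Y n m) :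
    Y.cast (Nat.zero_add n) (Nat.zero_add m) (b.app (SMOp.par (b.app SMOp.eps) f)) = f :=
  (fold_cast (𝟙 Y) (Nat.zero_add _) (Nat.zero_add _)
    (SMTerm.par SMTerm.eps (var f))).symm.trans (hb _ _ (.epsPar f))

theorem liftAlgebra_parAssoc (hb : Satisfies b) {n m n' m' n'' m'' : ℕ}
    (f : (Behaviour A κ).obj Y n m) (g : (Behaviour A κ).obj Y n' m')
    (h : (Behaviour A κ).obj Y n'' m'') :
    liftEval hκ hA b (SMEq.parAssoc f g h).lhs = liftEval hκ hA b (SMEq.parAssoc f g h).rhs := by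
  refine (fold_cast _ (Nat.add_assoc _ _ _) (Nat.add_assoc _ _ _)
    (SMTerm.par (SMTerm.par (var f) (var g)) (var h))).trans ?_
  apply behaviour_ext
  intro v x w
  refine (mem_cast _ _ _).trans (Iff.trans ?_ mem_liftAlgebra_par.symm)
  constructor
  · rintro ⟨v', x', w', hm, hv, rfl, hw⟩
    obtain ⟨v₁, c, w₁, v₂, d, w₂, h₁, h₂, rfl, rfl, rfl⟩ := mem_liftAlgebra_par.1 hm
    obtain ⟨v₃, c', w₃, v₄, d', w₄, h₃, h₄, rfl, rfl, rfl⟩ := mem_liftAlgebra_par.1 h₁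
    exact ⟨_, _, _, _, _, _, h₃, mem_liftAlgebra_par.2 ⟨_, _, _, _, _, _, h₄, h₂, rfl, rfl, rfl⟩,
      Subtype.ext (hv.trans (List.append_assoc _ _ _)), hb.parAssoc c' d' d,
      Subtype.ext (hw.trans (List.append_assoc _ _ _))⟩
  · rintro ⟨v₁, c, w₁, v₂, d, w₂, h₁, h₂, rfl, rfl, rfl⟩
    obtain ⟨v₃, c', w₃, v₄, d', w₄, h₃, h₄, rfl, rfl, rfl⟩ := mem_liftAlgebra_par.1 h₂
    exact ⟨_, _, _, mem_liftAlgebra_par.2 ⟨_, _, _, _, _, _,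
      mem_liftAlgebra_par.2 ⟨_, _, _, _, _, _, h₁, h₃, rfl, rfl, rfl⟩, h₄, rfl, rfl, rfl⟩,
      (List.append_assoc _ _ _).symm, (hb.parAssoc c c' d').symm,
      (List.append_assoc _ _ _).symm⟩

theorem liftAlgebra_epsPar (hb : Satisfies b) {n m : ℕ} (f : (Behaviour A κ).obj Y n m) :
    liftEval hκ hA b (SMEq.epsPar f).lhs = liftEval hκ hA b (SMEq.epsPar f).rhs := by
  refine (fold_cast _ (Nat.zero_add _) (Nat.zero_add _) (SMTerm.par SMTerm.eps (var f))).trans ?_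
  apply behaviour_ext
  intro v x w
  refine (mem_cast _ _ _).trans ?_
  constructor
  · rintro ⟨v', x', w', hm, hv, rfl, hw⟩
    obtain ⟨v₁, c, w₁, v₂, d, w₂, h₁, h₂, rfl, rfl, rfl⟩ := mem_liftAlgebra_par.1 hm
    cases mem_liftAlgebra_eps.1 h₁
    rw [hb.epsPar]
    cases v₁.eq_nil
    cases w₁.eq_nil
    cases Subtype.ext hv
    cases Subtype.ext hw
    exact h₂
  · intro h
    exact ⟨_, _, _, mem_liftAlgebra_par.2 ⟨⟨[], rfl⟩, _, ⟨[], rfl⟩, v, x, w,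
      mem_liftAlgebra_eps.2 rfl, h, rfl, rfl, rfl⟩, rfl, (hb.epsPar x).symm, rfl⟩

theorem liftAlgebra_parEps (hb : Satisfies b) {n m : ℕ} (f : (Behaviour A κ).obj Y n m) :
    liftEval hκ hA b (SMEq.parEps f).lhs = liftEval hκ hA b (SMEq.parEps f).rhs := by
  apply behaviour_ext
  intro v x w
  refine mem_liftAlgebra_par.trans ?_
  have append_nil : ∀ {k : ℕ} (a : List.Vector A k) (e : List.Vector A 0), a ++ e = a := by
    intro k a e
    cases e.eq_nil
    exact Subtype.ext (List.append_nil _)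
  constructor
  · rintro ⟨v₁, c, w₁, v₂, d, w₂, h₁, h₂, rfl, rfl, rfl⟩
    cases mem_liftAlgebra_eps.1 h₂
    rw [append_nil, append_nil]
    have e : b.app (SMOp.par c (b.app SMOp.eps)) = c := hb _ _ (.parEps c)
    rwa [e]
  · intro h
    exact ⟨v, x, w, ⟨[], rfl⟩, _, ⟨[], rfl⟩, h, mem_liftAlgebra_eps.2 rfl,
      (append_nil v _).symm, (hb _ _ (.parEps x)).symm, (append_nil w _).symm⟩

theorem liftAlgebra_symSym (hb : Satisfies b) :
    liftEval hκ hA b SMEq.symSym.lhs = liftEval hκ hA b SMEq.symSym.rhs := by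
  apply behaviour_ext
  intro v x w
  refine mem_liftAlgebra_seq.trans (Iff.trans ?_ mem_liftEval_idn.symm)
  constructor
  · rintro ⟨c, z, d, h₁, h₂, rfl⟩
    obtain ⟨rfl, k, l, hv, hz⟩ := mem_liftAlgebra_sym.1 h₁
    obtain ⟨rfl, k', l', hz', hw⟩ := mem_liftAlgebra_sym.1 h₂
    cases hz.symm.trans hz'
    exact ⟨hb _ _ .symSym, Subtype.ext (hv.trans hw.symm)⟩
  · rintro ⟨rfl, rfl⟩
    obtain ⟨v, hv⟩ := v
    obtain ⟨k, l, rfl⟩ := List.length_eq_two.1 hv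
    exact ⟨_, ⟨[l, k], rfl⟩, _, mem_liftAlgebra_sym.2 ⟨rfl, k, l, rfl, rfl⟩,
      mem_liftAlgebra_sym.2 ⟨rfl, l, k, rfl, rfl⟩, (hb _ _ .symSym).symm⟩

theorem liftAlgebra_interchange (hb : Satisfies b) {n k m n' k' m' : ℕ}
    (f : (Behaviour A κ).obj Y n k) (g : (Behaviour A κ).obj Y k m)
    (h : (Behaviour A κ).obj Y n' k') (i : (Behaviour A κ).obj Y k' m') :
    liftEval hκ hA b (SMEq.interchange f g h i).lhs =
      liftEval hκ hA b (SMEq.interchange f g h i).rhs := by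
  apply behaviour_ext
  intro v x w
  refine mem_liftAlgebra_par.trans (Iff.trans ?_ mem_liftAlgebra_seq.symm)
  constructor
  · rintro ⟨v₁, c, w₁, v₂, d, w₂, h₁, h₂, rfl, rfl, rfl⟩
    obtain ⟨c₁, z₁, d₁, h₃, h₄, rfl⟩ := mem_liftAlgebra_seq.1 h₁
    obtain ⟨c₂, z₂, d₂, h₅, h₆, rfl⟩ := mem_liftAlgebra_seq.1 h₂
    exact ⟨_, _, _, mem_liftAlgebra_par.2 ⟨_, _, _, _, _, _, h₃, h₅, rfl, rfl, rfl⟩,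
      mem_liftAlgebra_par.2 ⟨_, _, _, _, _, _, h₄, h₆, rfl, rfl, rfl⟩,
      hb _ _ (.interchange c₁ d₁ c₂ d₂)⟩
  · rintro ⟨c, z, d, h₁, h₂, rfl⟩
    obtain ⟨v₁, c₁, z₁, v₂, c₂, z₂, h₃, h₅, rfl, rfl, rfl⟩ := mem_liftAlgebra_par.1 h₁
    obtain ⟨z₁', d₁, w₁, z₂', d₂, w₂, h₄, h₆, hz, rfl, rfl⟩ := mem_liftAlgebra_par.1 h₂
    -- The two stages split the middle word at the same place, since the types fix the length of the
    -- left part.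
    obtain ⟨rfl, rfl⟩ := vector_append_inj hz
    exact ⟨_, _, _, _, _, _, mem_liftAlgebra_seq.2 ⟨_, _, _, h₃, h₄, rfl⟩,
      mem_liftAlgebra_seq.2 ⟨_, _, _, h₅, h₆, rfl⟩, rfl,
      (hb _ _ (.interchange c₁ d₁ c₂ d₂)).symm, rfl⟩

theorem liftAlgebra_seqAssoc (hb : Satisfies b) {n k l m : ℕ}
    (f : (Behaviour A κ).obj Y n k) (g : (Behaviour A κ).obj Y k l)
    (h : (Behaviour A κ).obj Y l m) :
    liftEval hκ hA b (SMEq.seqAssoc f g h).lhs = liftEval hκ hA b (SMEq.seqAssoc f g h).rhs := by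
  apply behaviour_ext
  intro v x w
  refine mem_liftAlgebra_seq.trans (Iff.trans ?_ mem_liftAlgebra_seq.symm)
  constructor
  · rintro ⟨_, z, d, h₁, h₂, rfl⟩
    obtain ⟨c, y, c', h₃, h₄, rfl⟩ := mem_liftAlgebra_seq.1 h₁
    exact ⟨_, _, _, h₃, mem_liftAlgebra_seq.2 ⟨_, _, _, h₄, h₂, rfl⟩,
      hb _ _ (.seqAssoc c c' d)⟩
  · rintro ⟨c, z, _, h₁, h₂, rfl⟩
    obtain ⟨c', y, d, h₃, h₄, rfl⟩ := mem_liftAlgebra_seq.1 h₂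
    exact ⟨_, _, _, mem_liftAlgebra_seq.2 ⟨_, _, _, h₁, h₃, rfl⟩, h₄,
      (hb _ _ (.seqAssoc c c' d)).symm⟩

theorem liftAlgebra_seqId (hb : Satisfies b) {n m : ℕ} (f : (Behaviour A κ).obj Y n m) :
    liftEval hκ hA b (SMEq.seqId f).lhs = liftEval hκ hA b (SMEq.seqId f).rhs := by
  apply behaviour_ext
  intro v x w
  refine mem_liftAlgebra_seq.trans ?_
  constructor
  · rintro ⟨c, z, d, h₁, h₂, rfl⟩
    obtain ⟨rfl, rfl⟩ := mem_liftEval_idn.1 h₂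
    have e : b.app (SMOp.seq c (fold (𝟙 Y) b (idn Y m))) = c := hb _ _ (.seqId c)
    rwa [e]
  · intro h
    exact ⟨x, w, _, h, mem_liftEval_idn.2 ⟨rfl, rfl⟩, (hb _ _ (.seqId x)).symm⟩

theorem liftAlgebra_idSeq (hb : Satisfies b) {n m : ℕ} (f : (Behaviour A κ).obj Y n m) :
    liftEval hκ hA b (SMEq.idSeq f).lhs = liftEval hκ hA b (SMEq.idSeq f).rhs := by
  apply behaviour_ext
  intro v x w
  refine mem_liftAlgebra_seq.trans ?_
  constructor
  · rintro ⟨c, z, d, h₁, h₂, rfl⟩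
    obtain ⟨rfl, rfl⟩ := mem_liftEval_idn.1 h₁
    have e : b.app (SMOp.seq (fold (𝟙 Y) b (idn Y n)) d) = d := hb _ _ (.idSeq d)
    rwa [e]
  · intro h
    exact ⟨_, v, x, mem_liftEval_idn.2 ⟨rfl, rfl⟩, h, (hb _ _ (.idSeq x)).symm⟩

theorem liftAlgebra_symOneNat (hb : Satisfies b) {n m : ℕ} (f : (Behaviour A κ).obj Y n m) :
    liftEval hκ hA b (SMEq.symOneNat f).lhs = liftEval hκ hA b (SMEq.symOneNat f).rhs := by
  apply behaviour_ext
  intro v x w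
  refine mem_liftAlgebra_seq.trans (Iff.trans ?_ mem_liftAlgebra_seq.symm)
  constructor
  · rintro ⟨c, z, d, h₁, h₂, rfl⟩
    obtain ⟨rfl, k, l, hv, hz⟩ := mem_liftEval_symOne.1 h₁
    obtain ⟨v₁, c', w₁, v₂, d', w₂, h₃, h₄, rfl, rfl, rfl⟩ := mem_liftAlgebra_par.1 h₂
    obtain ⟨rfl, rfl⟩ := mem_liftAlgebra_id.1 h₄
    obtain ⟨r, rfl⟩ := vector_one v₂
    obtain ⟨rfl, e⟩ := List.append_inj' hz rfl
    cases e
    -- On the other side `f` acts before the crossing, so the middle word is the untouched letter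
    -- `k` followed by the output of `f`.
    exact ⟨_, (letter k ++ w₁), _, mem_liftAlgebra_par.2 ⟨⟨[k], rfl⟩, _, ⟨[k], rfl⟩, v₁, c', w₁,
      mem_liftAlgebra_id.2 ⟨rfl, rfl⟩, h₃, Subtype.ext hv, rfl, rfl⟩,
      mem_liftEval_symOne.2 ⟨rfl, k, w₁.1, rfl, rfl⟩, hb _ _ (.symOneNat c')⟩
  · rintro ⟨c, z, d, h₁, h₂, rfl⟩
    obtain ⟨rfl, k, l, hz, hw⟩ := mem_liftEval_symOne.1 h₂
    obtain ⟨v₁, c', w₁, v₂, d', w₂, h₃, h₄, rfl, rfl, rfl⟩ := mem_liftAlgebra_par.1 h₁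
    obtain ⟨rfl, rfl⟩ := mem_liftAlgebra_id.1 h₃
    obtain ⟨r, rfl⟩ := vector_one v₁
    obtain ⟨e, rfl⟩ := List.append_inj (s₁ := [r]) (s₂ := [k]) hz rfl
    cases e
    exact ⟨_, (v₂ ++ letter k), _, mem_liftEval_symOne.2 ⟨rfl, k, v₂.1, rfl, rfl⟩,
      mem_liftAlgebra_par.2 ⟨v₂, d', w₂, ⟨[k], rfl⟩, _, ⟨[k], rfl⟩, h₄,
        mem_liftAlgebra_id.2 ⟨rfl, rfl⟩, rfl, rfl, Subtype.ext hw⟩,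
      (hb _ _ (.symOneNat d')).symm⟩

theorem liftAlgebra_oneSymNat (hb : Satisfies b) {n m : ℕ} (f : (Behaviour A κ).obj Y n m) :
    liftEval hκ hA b (SMEq.oneSymNat f).lhs = liftEval hκ hA b (SMEq.oneSymNat f).rhs := by
  apply behaviour_ext
  intro v x w
  refine mem_liftAlgebra_seq.trans (Iff.trans ?_ mem_liftAlgebra_seq.symm)
  constructor
  · rintro ⟨c, z, d, h₁, h₂, rfl⟩
    obtain ⟨rfl, k, l, hv, hz⟩ := mem_liftEval_oneSym.1 h₁
    obtain ⟨v₁, c', w₁, v₂, d', w₂, h₃, h₄, rfl, rfl, rfl⟩ := mem_liftAlgebra_par.1 h₂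
    obtain ⟨rfl, rfl⟩ := mem_liftAlgebra_id.1 h₃
    obtain ⟨r, rfl⟩ := vector_one v₁
    obtain ⟨e, rfl⟩ := List.append_inj (s₁ := [r]) (s₂ := [k]) hz rfl
    cases e
    exact ⟨_, (w₂ ++ letter k), _, mem_liftAlgebra_par.2 ⟨v₂, d', w₂, ⟨[k], rfl⟩, _, ⟨[k], rfl⟩,
      h₄, mem_liftAlgebra_id.2 ⟨rfl, rfl⟩, Subtype.ext hv, rfl, rfl⟩,
      mem_liftEval_oneSym.2 ⟨rfl, k, w₂.1, rfl, rfl⟩, hb _ _ (.oneSymNat d')⟩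
  · rintro ⟨c, z, d, h₁, h₂, rfl⟩
    obtain ⟨rfl, k, l, hz, hw⟩ := mem_liftEval_oneSym.1 h₂
    obtain ⟨v₁, c', w₁, v₂, d', w₂, h₃, h₄, rfl, rfl, rfl⟩ := mem_liftAlgebra_par.1 h₁
    obtain ⟨rfl, rfl⟩ := mem_liftAlgebra_id.1 h₄
    obtain ⟨r, rfl⟩ := vector_one v₂
    obtain ⟨rfl, e⟩ := List.append_inj' hz rfl
    cases e
    exact ⟨_, (letter k ++ v₁), _, mem_liftEval_oneSym.2 ⟨rfl, k, v₁.1, rfl, rfl⟩,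
      mem_liftAlgebra_par.2 ⟨⟨[k], rfl⟩, _, ⟨[k], rfl⟩, v₁, c', w₁,
        mem_liftAlgebra_id.2 ⟨rfl, rfl⟩, h₃, rfl, rfl, Subtype.ext hw⟩,
      (hb _ _ (.oneSymNat c')).symm⟩

theorem satisfies_liftAlgebra (hκ : ℵ₀ ≤ κ) (hA : #A ≤ κ) (Y : Sig.{u}) (b : SM.obj Y ⟶ Y)
    (hb : Satisfies b) : Satisfies (liftAlgebra (gsos A κ hκ hA) b) := by
  intro n m e
  cases e with
  | parAssoc f g h => exact liftAlgebra_parAssoc hb f g h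
  | epsPar f => exact liftAlgebra_epsPar hb f
  | parEps f => exact liftAlgebra_parEps hb f
  | symSym => exact liftAlgebra_symSym hb
  | interchange f g h i => exact liftAlgebra_interchange hb f g h i
  | seqAssoc f g h => exact liftAlgebra_seqAssoc hb f g h
  | seqId f => exact liftAlgebra_seqId hb f
  | idSeq f => exact liftAlgebra_idSeq hb f
  | symOneNat f => exact liftAlgebra_symOneNat hb f
  | oneSymNat f => exact liftAlgebra_oneSymNat hb f

end Preservation

/-! ### Symmetries and the prop of a model -/

section OperationSpace

open SMTerm Diagram

/-- The operations of all arities and coarities of an `S_SM`-algebra. -/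
structure Oper {X : Sig.{u}} (b : SM.obj X ⟶ X) : Type u where
  dom : ℕ
  cod : ℕ
  hom : X dom cod

namespace Oper

variable {X : Sig.{u}} {b : SM.obj X ⟶ X}

theorem mk_injective {n m : ℕ} {x y : X n m} (h : (⟨n, m, x⟩ : Oper b) = ⟨n, m, y⟩) : x = y := by
  cases h; rfl

/-- The reason for forgetting types: transports disappear in `Oper`, so that `⊗` becomes strictly
associative and unital. -/
theorem mk_cast {n m n' m' : ℕ} (hn : n = n') (hm : m = m') (x : X n m) :
    (⟨n', m', X.cast hn hm x⟩ : Oper b) = ⟨n, m, x⟩ := by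
  subst hn hm; rfl

/-- Sequential composition; its value is irrelevant if the types do not match. -/
def comp (f g : Oper b) : Oper b :=
  if h : f.cod = g.dom then ⟨f.dom, g.cod, b.app (SMOp.seq f.hom (X.cast h.symm rfl g.hom))⟩ else f

local infixl:65 " ⊚ " => Oper.comp

theorem mk_comp {n k m : ℕ} (x : X n k) (y : X k m) :
    (⟨n, k, x⟩ ⊚ ⟨k, m, y⟩ : Oper b) = ⟨n, m, b.app (SMOp.seq x y)⟩ := by
  simp [comp, Sig.cast]

@[simp] theorem dom_comp (f g : Oper b) : (f ⊚ g).dom = f.dom := by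
  unfold comp; split <;> rfl

theorem cod_comp {f g : Oper b} (h : f.cod = g.dom) : (f ⊚ g).cod = g.cod := by
  rw [comp, dif_pos h]

variable (b) in
/-- Identities. -/
def ident (n : ℕ) : Oper b := ⟨n, n, fold (𝟙 X) b (idn X n)⟩

@[simp] theorem dom_ident (n : ℕ) : (ident b n).dom = n := rfl

@[simp] theorem cod_ident (n : ℕ) : (ident b n).cod = n := rfl

variable (b) in
/-- The symmetry on `1, 1`. -/
def swap : Oper b := ⟨2, 2, b.app SMOp.sym⟩

@[simp] theorem dom_swap : (swap b).dom = 2 := rfl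

@[simp] theorem cod_swap : (swap b).cod = 2 := rfl

variable (b) in
/-- The symmetry on `1, n`. -/
def swapOne (n : ℕ) : Oper b := ⟨1 + n, n + 1, fold (𝟙 X) b (symOne X n)⟩

@[simp] theorem dom_swapOne (n : ℕ) : (swapOne b n).dom = 1 + n := rfl

@[simp] theorem cod_swapOne (n : ℕ) : (swapOne b n).cod = n + 1 := rfl

variable (b) in
/-- The symmetry on `n, 1`. -/
def oneSwap (n : ℕ) : Oper b := ⟨n + 1, 1 + n, fold (𝟙 X) b (oneSym X n)⟩

@[simp] theorem dom_oneSwap (n : ℕ) : (oneSwap b n).dom = n + 1 := rfl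

@[simp] theorem cod_oneSwap (n : ℕ) : (oneSwap b n).cod = 1 + n := rfl

theorem mk_ident (n : ℕ) : (⟨n, n, fold (𝟙 X) b (idn X n)⟩ : Oper b) = ident b n := rfl

variable [hb : Fact (Satisfies b)]

/-- The monoid laws are the equations for `⊗` and `ε`. Holding `Satisfies b` as a `Fact` makes this
instance available to rewriting. -/
instance : Monoid (Oper b) where
  mul f g := ⟨f.dom + g.dom, f.cod + g.cod, b.app (SMOp.par f.hom g.hom)⟩
  one := ⟨0, 0, b.app SMOp.eps⟩
  mul_assoc f g h := (mk_cast (Nat.add_assoc _ _ _) (Nat.add_assoc _ _ _) _).symm.trans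
    (congrArg (Oper.mk _ _) (hb.out.parAssoc f.hom g.hom h.hom))
  one_mul f := (mk_cast (Nat.zero_add _) (Nat.zero_add _) _).symm.trans
    (congrArg (Oper.mk _ _) (hb.out.epsPar f.hom))
  mul_one f := congrArg (Oper.mk f.dom f.cod) (hb.out _ _ (.parEps f.hom))

theorem mk_mul {n m n' m' : ℕ} (x : X n m) (y : X n' m') :
    (⟨n, m, x⟩ * ⟨n', m', y⟩ : Oper b) = ⟨n + n', m + m', b.app (SMOp.par x y)⟩ := rfl

@[simp] theorem dom_mul (f g : Oper b) : (f * g).dom = f.dom + g.dom := rfl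

@[simp] theorem cod_mul (f g : Oper b) : (f * g).cod = f.cod + g.cod := rfl

theorem comp_assoc {f g h : Oper b} (h₁ : f.cod = g.dom) (h₂ : g.cod = h.dom) :
    f ⊚ g ⊚ h = f ⊚ (g ⊚ h) := by
  obtain ⟨n, k, f⟩ := f
  obtain ⟨k', l, g⟩ := g
  obtain ⟨l', m, h⟩ := h
  obtain rfl : k = k' := h₁
  obtain rfl : l = l' := h₂
  simp only [mk_comp]
  exact congrArg (Oper.mk _ _) (hb.out _ _ (.seqAssoc f g h))

theorem mul_comp_mul {f g f' g' : Oper b} (h₁ : f.cod = g.dom) (h₂ : f'.cod = g'.dom) :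
    f * f' ⊚ g * g' = (f ⊚ g) * (f' ⊚ g') := by
  obtain ⟨n, k, f⟩ := f
  obtain ⟨k', l, g⟩ := g
  obtain ⟨n', m, f'⟩ := f'
  obtain ⟨m', l', g'⟩ := g'
  obtain rfl : k = k' := h₁
  obtain rfl : m = m' := h₂
  simp only [mk_comp, mk_mul]
  exact congrArg (Oper.mk _ _) (hb.out _ _ (.interchange f g f' g')).symm

theorem ident_comp {f : Oper b} {n : ℕ} (h : f.dom = n) : ident b n ⊚ f = f := by
  obtain ⟨n', m, f⟩ := f
  obtain rfl : n' = n := h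
  exact (mk_comp _ _).trans (congrArg (Oper.mk _ _) (hb.out _ _ (.idSeq f)))

theorem comp_ident {f : Oper b} {n : ℕ} (h : f.cod = n) : f ⊚ ident b n = f := by
  obtain ⟨n', m, f⟩ := f
  obtain rfl : m = n := h
  exact (mk_comp _ _).trans (congrArg (Oper.mk _ _) (hb.out _ _ (.seqId f)))

theorem ident_zero : ident b 0 = 1 := rfl

theorem ident_one : ident b 1 = ⟨1, 1, b.app SMOp.id1⟩ := one_mul (⟨1, 1, b.app SMOp.id1⟩ : Oper b)

theorem ident_succ (n : ℕ) : ident b (n + 1) = ident b n * ident b 1 := by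
  rw [ident_one]; rfl

theorem ident_add (n m : ℕ) : ident b (n + m) = ident b n * ident b m := by
  induction m with
  | zero => rw [ident_zero, mul_one]; rfl
  | succ m ih => rw [← add_assoc, ident_succ, ih, ident_succ m, mul_assoc]

theorem swap_comp_swap : swap b ⊚ swap b = ident b 2 :=
  (mk_comp _ _).trans (congrArg (Oper.mk _ _) (hb.out _ _ .symSym))

theorem swapOne_zero : swapOne b 0 = ident b 1 := ident_one.symm

theorem oneSwap_zero : oneSwap b 0 = ident b 1 := ident_one.symm

theorem swapOne_succ (n : ℕ) :
    swapOne b (n + 1) = swapOne b n * ident b 1 ⊚ ident b n * swap b := by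
  rw [ident_one]
  exact (mk_comp _ _).symm

theorem oneSwap_succ (n : ℕ) :
    oneSwap b (n + 1) = ident b n * swap b ⊚ oneSwap b n * ident b 1 := by
  rw [ident_one]
  exact (mk_comp _ _).symm

theorem swapOne_natural (f : Oper b) :
    swapOne b f.dom ⊚ f * ident b 1 = ident b 1 * f ⊚ swapOne b f.cod := by
  rw [ident_one]
  exact (mk_comp _ _).trans ((congrArg (Oper.mk _ _) (hb.out _ _ (.symOneNat f.hom))).trans
    (mk_comp _ _).symm)

theorem oneSwap_natural (f : Oper b) :
    oneSwap b f.dom ⊚ ident b 1 * f = f * ident b 1 ⊚ oneSwap b f.cod := by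
  rw [ident_one]
  exact (mk_comp _ _).trans ((congrArg (Oper.mk _ _) (hb.out _ _ (.oneSymNat f.hom))).trans
    (mk_comp _ _).symm)

/-- Whiskering on the right. -/
theorem comp_mul_ident {f g : Oper b} (h : f.cod = g.dom) (n : ℕ) :
    (f ⊚ g) * ident b n = f * ident b n ⊚ g * ident b n := by
  rw [mul_comp_mul h rfl, ident_comp (dom_ident n)]

/-- Whiskering on the left. -/
theorem ident_mul_comp {f g : Oper b} (h : f.cod = g.dom) (n : ℕ) :
    ident b n * (f ⊚ g) = ident b n * f ⊚ ident b n * g := by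
  rw [mul_comp_mul rfl h, ident_comp (dom_ident n)]

theorem mul_ident_comp_ident_mul {f g : Oper b} {n m : ℕ} (hn : f.cod = n) (hm : g.dom = m) :
    f * ident b m ⊚ ident b n * g = f * g := by
  rw [mul_comp_mul hn hm.symm, ident_comp hm, comp_ident hn]

theorem ident_mul_comp_mul_ident {f g : Oper b} {n m : ℕ} (hn : f.dom = n) (hm : g.cod = m) :
    ident b n * g ⊚ f * ident b m = f * g := by
  rw [mul_comp_mul hn.symm hm, ident_comp hn, comp_ident hm]

/-- Cancels `f ; g ; g' ; f'` from the inside; used where a symmetry and its inverse are unfolded by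
mirror-image recursions. -/
theorem comp_cancel_middle {f g g' f' : Oper b} {n m : ℕ} (hg : g ⊚ g' = ident b n)
    (hf : f ⊚ f' = ident b m) (h₁ : f.cod = n) (h₂ : g.dom = n) (h₃ : g.cod = g'.dom)
    (h₄ : g'.cod = n) (h₅ : f'.dom = n) : f ⊚ g ⊚ (g' ⊚ f') = ident b m := by
  have e : g ⊚ (g' ⊚ f') = f' := by
    rw [← comp_assoc h₃ (h₄.trans h₅.symm), hg, ident_comp h₅]
  rw [comp_assoc (h₁.trans h₂.symm) (by rw [dom_comp, h₃]), e, hf]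

theorem swapOne_comp_oneSwap (n : ℕ) : swapOne b n ⊚ oneSwap b n = ident b (1 + n) := by
  induction n with
  | zero => rw [swapOne_zero, oneSwap_zero]; exact ident_comp rfl
  | succ n ih =>
    rw [swapOne_succ, oneSwap_succ]
    refine comp_cancel_middle (n := n + 2) ?_ ?_ ?_ ?_ ?_ ?_ ?_
    · rw [← ident_mul_comp rfl, swap_comp_swap, ident_add]
    · rw [← comp_mul_ident rfl, ih, ← add_assoc, ident_add (1 + n)]
    all_goals simp

variable (b) in
/-- The symmetry on `n, m`. -/
def braid : ℕ → ℕ → Oper b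
  | 0, m => ident b m
  | n + 1, m => ident b n * swapOne b m ⊚ braid n m * ident b 1

@[simp] theorem dom_braid (n m : ℕ) : (braid b n m).dom = n + m := by
  cases n with
  | zero => simp [braid]
  | succ n => simp [braid, add_assoc]

@[simp] theorem cod_braid (n m : ℕ) : (braid b n m).cod = m + n := by
  induction n with
  | zero => simp [braid]
  | succ n ih => rw [braid, cod_comp (by simp [add_assoc]), cod_mul, ih, cod_ident, add_assoc]

theorem braid_zero (n : ℕ) : braid b n 0 = ident b n := by
  induction n with
  | zero => rfl
  | succ n ih => rw [braid, ih, swapOne_zero, ← ident_succ, ident_comp (dom_ident _)]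

theorem braid_one_right (n : ℕ) : braid b n 1 = oneSwap b n := by
  induction n with
  | zero => exact oneSwap_zero.symm
  | succ n ih =>
    have e : swapOne b 1 = swap b := by
      rw [← zero_add 1, swapOne_succ, swapOne_zero, ident_zero, one_mul, ← ident_add,
        ident_comp dom_swap]
    rw [braid, ih, oneSwap_succ, e]

theorem braid_one_one : braid b 1 1 = swap b := by
  rw [braid_one_right, ← zero_add 1, oneSwap_succ, oneSwap_zero, ident_zero, one_mul,
    ← ident_add, comp_ident cod_swap]

/-- The symmetry on `n, m + 1`. -/
theorem braid_succ (n m : ℕ) :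
    braid b n (m + 1) = braid b n m * ident b 1 ⊚ ident b m * oneSwap b n := by
  induction n with
  | zero =>
    rw [braid, braid, oneSwap_zero, ← ident_succ, ident_comp (dom_ident _)]
  | succ n ih =>
    rw [braid, braid, ih, swapOne_succ, oneSwap_succ, comp_mul_ident (by simp [add_assoc]),
      comp_mul_ident (by simp; omega), ident_mul_comp (by simp), ident_mul_comp (by simp)]
    simp only [← mul_assoc, ← ident_add]
    -- The swap of the last two wires and the symmetry on the first `n + m` wires touch disjoint
    -- wires, hence commute. This reconciles the recursions in the first and the second argument.
    have e : ident b (n + m) * swap b ⊚ braid b n m * ident b 1 * ident b 1 =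
        braid b n m * ident b 1 * ident b 1 ⊚ ident b (m + n) * swap b := by
      rw [mul_assoc, ← ident_add, mul_ident_comp_ident_mul (cod_braid n m) dom_swap,
        ident_mul_comp_mul_ident (dom_braid n m) cod_swap]
    rw [comp_assoc, ← comp_assoc (f := ident b (n + m) * swap b), e, comp_assoc, ← comp_assoc,
      ← comp_assoc]
    all_goals first | rfl | simp [cod_comp, add_assoc]

/-- The recursion in the first argument crosses one wire at a time, and `swapOne_natural` slides `g`
past each. The next lemma uses `braid_succ` and `oneSwap_natural` in the same way. -/
theorem braid_natural_right (g : Oper b) (n : ℕ) :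
    braid b n g.dom ⊚ g * ident b n = ident b n * g ⊚ braid b n g.cod := by
  induction n with
  | zero =>
    rw [braid, braid, ident_zero, one_mul, mul_one, ident_comp rfl, comp_ident rfl]
  | succ n ih =>
    rw [braid, braid, ident_succ n, ← mul_assoc, comp_assoc, ← comp_mul_ident, ih, comp_mul_ident,
      mul_assoc (ident b n), ← comp_assoc, ← ident_mul_comp, swapOne_natural, ident_mul_comp,
      ← mul_assoc, comp_assoc]
    all_goals simp [add_assoc]

theorem braid_natural_left (f : Oper b) (m : ℕ) :
    braid b f.dom m ⊚ ident b m * f = f * ident b m ⊚ braid b f.cod m := by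
  induction m with
  | zero =>
    rw [braid_zero, braid_zero, ident_zero, one_mul, mul_one, ident_comp rfl, comp_ident rfl]
  | succ m ih =>
    rw [braid_succ, braid_succ, ident_succ m, mul_assoc (ident b m), comp_assoc, ← ident_mul_comp,
      oneSwap_natural, ident_mul_comp, ← mul_assoc (ident b m), ← comp_assoc, ← comp_mul_ident,
      ih, comp_mul_ident, ← mul_assoc, comp_assoc]
    all_goals simp [add_assoc]

theorem braid_natural (f g : Oper b) :
    braid b f.dom g.dom ⊚ g * f = f * g ⊚ braid b f.cod g.cod := by
  rw [← mul_ident_comp_ident_mul (f := g) (g := f) rfl rfl, ← comp_assoc, braid_natural_right,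
    comp_assoc, braid_natural_left, ← comp_assoc, ident_mul_comp_mul_ident]
  all_goals simp

theorem braid_comp_braid (n m : ℕ) : braid b n m ⊚ braid b m n = ident b (n + m) := by
  induction n with
  | zero => rw [braid_zero, braid, zero_add, ident_comp (dom_ident m)]
  | succ n ih =>
    rw [braid, braid_succ]
    refine comp_cancel_middle (n := n + m + 1) ?_ ?_ ?_ ?_ ?_ ?_ ?_
    · rw [← comp_mul_ident, ih, ← ident_succ]
      simp
    · rw [← ident_mul_comp rfl, swapOne_comp_oneSwap, ← ident_add, add_assoc]
    all_goals simp [add_assoc]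

/-- This is the hexagon; `braid_succ` is the case `p = 1`, up to the identification of `oneSwap`
with the symmetry on `n, 1`. -/
theorem braid_add (n m p : ℕ) :
    braid b n (m + p) = braid b n m * ident b p ⊚ ident b m * braid b n p := by
  induction p with
  | zero =>
    rw [braid_zero, ident_zero, mul_one, ← ident_add]
    exact (comp_ident (cod_braid n m)).symm
  | succ p ih =>
    rw [← add_assoc, braid_succ, ih, braid_succ, comp_mul_ident, comp_assoc, ident_add m p,
      mul_assoc (ident b m) (ident b p), mul_assoc (ident b m) (braid b n p), ← ident_mul_comp,
      mul_assoc (braid b n m), ← ident_succ]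
    all_goals simp [add_assoc]

variable (b) in
/-- The symmetry on `n, m` as an operation. -/
def symmetry (n m : ℕ) : X (n + m) (m + n) :=
  X.cast (dom_braid n m) (cod_braid n m) (braid b n m).hom

theorem mk_symmetry (n m : ℕ) : (⟨n + m, m + n, symmetry b n m⟩ : Oper b) = braid b n m :=
  mk_cast _ _ _

end Oper

open Oper

/-- The prop of an `S_SM`-algebra satisfying the equations. -/
def propOfAlgebra {X : Sig.{u}} (b : SM.obj X ⟶ X) (hb : Satisfies b) : PropStr X :=
  haveI : Fact (Satisfies b) := ⟨hb⟩
  { id := fun n => fold (𝟙 X) b (idn X n)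
    seq := fun x y => b.app (SMOp.seq x y)
    par := fun x y => b.app (SMOp.par x y)
    symm := symmetry b
    id_seq := fun f => hb _ _ (.idSeq f)
    seq_id := fun f => hb _ _ (.seqId f)
    seq_assoc := fun f g h => hb _ _ (.seqAssoc f g h)
    par_id := fun n m => mk_injective (b := b) (ident_add n m).symm
    par_seq := fun f g f' g' => hb _ _ (.interchange f g f' g')
    par_assoc := hb.parAssoc
    zero_par := hb.epsPar
    par_zero := fun f => hb _ _ (.parEps f)
    symm_natural := fun {n n' m m'} f g => mk_injective (b := b) (by
      rw [← mk_comp, ← mk_comp, mk_symmetry, mk_symmetry, ← mk_mul, ← mk_mul]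
      exact braid_natural ⟨n, n', f⟩ ⟨m, m', g⟩)
    symm_symm := fun n m => mk_injective (b := b) (by
      rw [← mk_comp, mk_symmetry, mk_symmetry, mk_ident]
      exact braid_comp_braid n m)
    hexagon := fun n m p => mk_injective (b := b) (by
      rw [← mk_comp, mk_cast, mk_cast, ← mk_mul, ← mk_mul, mk_ident, mk_ident, mk_symmetry,
        mk_symmetry, mk_symmetry]
      exact (braid_add n m p).symm) }

end OperationSpace

/-! ### Props are determined by their basic operations -/

namespace PropStr

variable {X Y : Sig.{u}} (P : PropStr X) (Q : PropStr Y)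

/-- The hexagon for `n, 0, 0` makes this symmetry idempotent, and an invertible idempotent is an
identity. -/
theorem symm_zero (n : ℕ) : X.cast rfl (Nat.zero_add n) (P.symm n 0) = P.id n := by
  -- `0 + n` is `n` only propositionally, so the cancellation is done for a variable `k`, where the
  -- equality can be substituted.
  have key : ∀ {k m : ℕ} (h : k = n) (h₂ : n = k) (h₃ : k = m) (s : X n k) (t : X k n),
      P.seq s t = P.id n → P.seq s (X.cast h₂ h₃ s) = X.cast rfl h₃ s →
        X.cast rfl h s = P.id n := by
    intro k m h h₂ h₃ s t hst hss
    subst h h₃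
    change P.seq s s = s at hss
    change s = _
    calc s = P.seq s (P.seq s t) := by rw [hst, P.seq_id]
      _ = P.id k := by rw [← P.seq_assoc, hss, hst]
  refine key (m := 0 + 0 + n) (Nat.zero_add n) (Nat.zero_add n).symm (by omega) _ (P.symm 0 n)
    (P.symm_symm n 0) ?_
  have e : ∀ {a a' c c' : ℕ} (h₁ : a = c) (h₂ : a' = c') (x : X a a') (y : X c c'),
      X.cast h₁ h₂ x = y → ∀ {d d' : ℕ} (h₃ : a = d) (h₄ : a' = d') (h₅ : c = d) (h₆ : c' = d'),
        X.cast h₃ h₄ x = X.cast h₅ h₆ y := by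
    intro a a' c c' h₁ h₂ x y h d d' h₃ h₄ h₅ h₆
    subst h₁ h₂ h
    rfl
  have hex := P.hexagon n 0 0
  rw [P.par_zero, e _ _ _ _ (P.zero_par (P.symm n 0)) _ _ (Nat.zero_add n).symm (by omega)] at hex
  exact hex

/-- The hexagon builds `σ_{1,n}` from `σ_{1,1}`, inversion passes to `σ_{n,1}`, and the hexagon
again builds `σ_{n,m}`; the cases with a zero are `symm_zero`. -/
theorem isPropHom_of_map {f : X ⟶ Y}
    (map_seq : ∀ {n k m : ℕ} (x : X n k) (y : X k m),
      f.app (P.seq x y) = Q.seq (f.app x) (f.app y))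
    (map_par : ∀ {n m n' m' : ℕ} (x : X n m) (y : X n' m'),
      f.app (P.par x y) = Q.par (f.app x) (f.app y))
    (map_id_zero : f.app (P.id 0) = Q.id 0) (map_id_one : f.app (P.id 1) = Q.id 1)
    (map_symm_one_one : f.app (P.symm 1 1) = Q.symm 1 1) : IsPropHom P Q f := by
  have map_id : ∀ n : ℕ, f.app (P.id n) = Q.id n := by
    intro n
    induction n with
    | zero => exact map_id_zero
    | succ n ih => rw [← P.par_id, ← Q.par_id, map_par, ih, map_id_one]
  have cast_inj : ∀ {n m n' m' : ℕ} (hn : n = n') (hm : m = m') {x y : Y n m},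
      Y.cast hn hm x = Y.cast hn hm y → x = y := by
    intro n m n' m' hn hm x y h
    subst hn hm
    exact h
  have map_symm_zero : ∀ n : ℕ, f.app (P.symm n 0) = Q.symm n 0 := by
    intro n
    apply cast_inj rfl (Nat.zero_add n)
    rw [Q.symm_zero, ← map_id, ← P.symm_zero, Sig.app_cast]
  have map_symm_add : ∀ n m p : ℕ, f.app (P.symm n m) = Q.symm n m →
      f.app (P.symm n p) = Q.symm n p → f.app (P.symm n (m + p)) = Q.symm n (m + p) := by
    intro n m p h h'
    apply cast_inj (Nat.add_assoc n m p).symm rfl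
    rw [← Q.hexagon, ← Sig.app_cast, ← P.hexagon, map_seq, Sig.app_cast, map_par, map_par, h, h',
      map_id, map_id]
  have map_symm_one : ∀ n : ℕ, f.app (P.symm 1 n) = Q.symm 1 n := by
    intro n
    induction n with
    | zero => exact map_symm_zero 1
    | succ n ih => exact map_symm_add 1 n 1 ih map_symm_one_one
  -- The image of `σ_{m,n}` and `σ_{m,n}` itself are both inverse to `σ_{n,m}`.
  have map_symm_swap : ∀ n m : ℕ, f.app (P.symm n m) = Q.symm n m →
      f.app (P.symm m n) = Q.symm m n := by
    intro n m h
    rw [← Q.seq_id (f.app _), ← Q.symm_symm n m, ← Q.seq_assoc, ← h, ← map_seq, P.symm_symm,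
      map_id, Q.id_seq]
  refine ⟨map_id, map_seq, map_par, fun n m => ?_⟩
  induction m with
  | zero => exact map_symm_zero n
  | succ m ih => exact map_symm_add n m 1 ih (map_symm_swap 1 n (map_symm_one n))

variable {P Q}

open SMTerm Diagram

/-- Algebra morphisms are morphisms of the underlying props. -/
theorem Realizes.isPropHom {a : PropMonad.obj X ⟶ X} {c : PropMonad.obj Y ⟶ Y}
    (hP : P.Realizes a) (hQ : Q.Realizes c) {f : X ⟶ Y}
    (hf : PropMonad.map f ≫ c = a ≫ f) : IsPropHom P Q f := by
  have key : ∀ {n m : ℕ} (t : SMTerm X n m),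
      f.app (a.app ((proj X).app t)) = c.app ((proj Y).app ((mapHom f).app t)) := by
    intro n m t
    have h : f.app (a.app ((proj X).app t)) = c.app ((mapD f).app ((proj X).app t)) :=
      congrArg (fun k : Diagram X ⟶ Y => k.app ((proj X).app t)) hf.symm
    have h' : (mapD f).app ((proj X).app t) = (proj Y).app ((mapHom f).app t) :=
      congrArg (fun k : SMTermSig X ⟶ Diagram Y => k.app t) (proj_mapD f)
    rw [h, h']
  refine isPropHom_of_map P Q ?_ ?_ ?_ ?_ ?_
  · intro n k m x y
    rw [hP.seq, hQ.seq, key]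
    rfl
  · intro n m n' m' x y
    rw [hP.par, hQ.par, key]
    rfl
  · rw [hP.id_zero, hQ.id_zero, key]
    rfl
  · rw [hP.id_one, hQ.id_one, key]
    rfl
  · rw [hP.symm_one_one, hQ.symm_one_one, key]
    rfl

/-- The identity is an algebra morphism, hence a prop morphism between the two structures, and so
all their operations coincide. -/
theorem Realizes.unique {P' : PropStr X} {a : PropMonad.obj X ⟶ X} (h : P.Realizes a)
    (h' : P'.Realizes a) : P = P' := by
  have hom : IsPropHom P P' (𝟙 X) := h.isPropHom h' (by
    rw [PropMonad.toFunctor.map_id]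
    exact (Category.id_comp a).trans (Category.comp_id a).symm)
  apply PropStr.ext
  · funext n
    exact hom.map_id n
  · funext n k m x y
    exact hom.map_seq x y
  · funext n m n' m' x y
    exact hom.map_par x y
  · funext n m
    exact hom.map_symm n m

/-- Only two clauses need an argument: the recursive `id_1` is `ε ⊗ id_1`, and the recursive
`σ_{1,1}` must reduce to the generator. -/
theorem exists_realizes {a : PropMonad.obj X ⟶ X} (unit : PropMonad.η.app X ≫ a = 𝟙 X)
    (assoc : PropMonad.μ.app X ≫ a = PropMonad.map a ≫ a) :
    ∃ P : PropStr X, P.Realizes a :=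
  ⟨propOfAlgebra (underlyingAlgebra a) (satisfies_underlyingAlgebra unit assoc),
    { seq := fun _ _ => rfl
      id_one := Oper.mk_injective (b := underlyingAlgebra a)
        (@Oper.ident_one _ _ ⟨satisfies_underlyingAlgebra unit assoc⟩)
      par := fun _ _ => rfl
      id_zero := rfl
      symm_one_one := Oper.mk_injective (b := underlyingAlgebra a) (by
        have : Fact (Satisfies (underlyingAlgebra a)) :=
          ⟨satisfies_underlyingAlgebra unit assoc⟩
        exact (Oper.mk_symmetry 1 1).trans Oper.braid_one_one) }⟩

end PropStr

/-! ### Existence of a final coalgebra -/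

section FinalCoalgebra

/-- Sets of at most `κ` transitions between states in `X`, with labels in `K` and `L`. -/
def TransitionSet (K L : Type u) (κ : Cardinal.{u}) (X : Type u) : Type u :=
  {U : Set (K × X × L) // #U ≤ κ}

variable {K L : Type u} {κ : Cardinal.{u}}

instance : Functor (TransitionSet K L κ) where
  map f U := ⟨(fun t => (t.1, f t.2.1, t.2.2)) '' U.1, mk_image_le.trans U.2⟩

theorem exists_subset_equiv {α : Type u} (U : Set α) (h : #U ≤ κ) :
    ∃ D : Set κ.out, Nonempty (D ≃ U) := by
  rw [← κ.mk_out] at h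
  obtain ⟨e⟩ := h
  exact ⟨Set.range e, ⟨(Equiv.ofInjective e e.injective).symm⟩⟩

/-- A set of at most `κ` transitions is enumerated by some subset `D` of a fixed set of size `κ`.
The shape records `D` and the labels, the children are the states, and `abs` forgets the
enumeration. -/
noncomputable instance : QPF (TransitionSet K L κ) where
  P := ⟨Σ D : Set κ.out, (D → K × L), fun a => a.1⟩
  abs p := ⟨Set.range fun d => ((p.1.2 d).1, p.2 d, (p.1.2 d).2), mk_range_le.trans
    ((mk_set_le _).trans (mk_out κ).le)⟩
  repr U :=
    ⟨⟨(exists_subset_equiv U.1 U.2).choose, fun d =>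
      let t := ((exists_subset_equiv U.1 U.2).choose_spec.some d).1
      (t.1, t.2.2)⟩, fun d => ((exists_subset_equiv U.1 U.2).choose_spec.some d).1.2.1⟩
  abs_repr U := by
    apply Subtype.ext
    exact ((exists_subset_equiv U.1 U.2).choose_spec.some.surjective.range_comp
      Subtype.val).trans Subtype.range_coe
  abs_map f p := by
    apply Subtype.ext
    exact Set.range_comp (fun t : K × _ × L => (t.1, f t.2.1, t.2.2))
      (fun d => ((p.1.2 d).1, p.2 d, (p.1.2 d).2))

/-- Coalgebra morphisms into the final coalgebra of transition sets are unique. -/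
theorem cofix_hom_ext {X : Type u} (c : X → TransitionSet K L κ X)
    {f g : X → QPF.Cofix (TransitionSet K L κ)}
    (hf : ∀ x, QPF.Cofix.dest (f x) = f <$> c x) (hg : ∀ x, QPF.Cofix.dest (g x) = g <$> c x) :
    f = g := by
  funext x
  -- The candidate bisimulation consists of the pairs `(f x, g x)`; successors need only agree after
  -- it is quotiented out.
  refine QPF.Cofix.bisim_rel (fun a a' => ∃ x, a = f x ∧ a' = g x) ?_ _ _ ⟨x, rfl, rfl⟩
  rintro _ _ ⟨y, rfl, rfl⟩
  rw [hf, hg, ← QPF.comp_map, ← QPF.comp_map]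
  congr 1
  funext z
  exact Quot.sound ⟨z, rfl, rfl⟩

/-- The final coalgebra of the behaviour functor. -/
noncomputable def finalCoalgebra (A : Type u) (κ : Cardinal.{u}) :
    Endofunctor.Coalgebra (Behaviour A κ) where
  V := fun n m => QPF.Cofix (TransitionSet (List.Vector A n) (List.Vector A m) κ)
  str := ⟨fun x => QPF.Cofix.dest x⟩

/-- Transitions preserve arity and coarity, so the behaviour functor acts on each fibre separately
and finality is checked fibrewise. -/
theorem exists_final (A : Type u) (κ : Cardinal.{u}) :
    ∃ Ω : Endofunctor.Coalgebra (Behaviour A κ), Nonempty (Limits.IsTerminal Ω) := by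
  refine ⟨finalCoalgebra A κ, ⟨Limits.IsTerminal.ofUniqueHom
    (fun c => ⟨⟨fun {n m} x => QPF.Cofix.corec
      (F := TransitionSet (List.Vector A n) (List.Vector A m) κ)
      (fun y : c.V n m => c.str.app y) x⟩, ?_⟩) ?_⟩⟩
  · apply Sig.hom_ext
    intro n m x
    exact (QPF.Cofix.dest_corec (F := TransitionSet (List.Vector A n) (List.Vector A m) κ)
      (fun y : c.V n m => c.str.app y) x).symm
  · intro c h
    apply Endofunctor.Coalgebra.Hom.ext
    apply Sig.hom_ext
    intro n m x
    refine congrFun (cofix_hom_ext (K := List.Vector A n) (L := List.Vector A m) (κ := κ)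
      (fun y : c.V n m => c.str.app y) (f := fun y => h.f.app y) (fun y => ?_)
      (QPF.Cofix.dest_corec _)) x
    exact (congrArg (fun k : c.V ⟶ (Behaviour A κ).obj (finalCoalgebra A κ).V => k.app y)
      h.h).symm

end FinalCoalgebra

/-! ### Bisimilarity as the kernel of the final map -/

section Bisimilarity

variable {A : Type u} {κ : Cardinal.{u}} {X : Sig.{u}}

theorem mem_behaviour_map {Y : Sig.{u}} (f : X ⟶ Y) {n m : ℕ} {U : (Behaviour A κ).obj X n m}
    {v : List.Vector A n} {y : Y n m} {w : List.Vector A m} :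
    (v, y, w) ∈ transitions (((Behaviour A κ).map f).app U) ↔
      ∃ x, (v, x, w) ∈ transitions U ∧ f.app x = y := by
  constructor
  · rintro ⟨⟨v, x, w⟩, h, e⟩
    cases e
    exact ⟨x, h, rfl⟩
  · rintro ⟨x, h, rfl⟩
    exact ⟨_, h, rfl⟩

/-- The kernel of a coalgebra morphism is a bisimulation. -/
theorem isBisimulation_ker {Y : Sig.{u}} {c : X ⟶ (Behaviour A κ).obj X}
    {c' : Y ⟶ (Behaviour A κ).obj Y} {f : X ⟶ Y} (hf : c ≫ (Behaviour A κ).map f = f ≫ c') :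
    IsBisimulation c (fun {_ _} x y => f.app x = f.app y) := by
  intro n m x y h
  have key : ((Behaviour A κ).map f).app (c.app x) = ((Behaviour A κ).map f).app (c.app y) := by
    have e : ∀ z : X n m, ((Behaviour A κ).map f).app (c.app z) = c'.app (f.app z) := fun z =>
      congrArg (fun k : X ⟶ (Behaviour A κ).obj Y => k.app z) hf
    rw [e, e, h]
  constructor
  · intro v x' w hx
    have := mem_behaviour_map f |>.2 ⟨x', hx, rfl⟩
    rw [key] at this
    obtain ⟨y', hy, e⟩ := (mem_behaviour_map f).1 this
    exact ⟨y', hy, e.symm⟩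
  · intro v y' w hy
    have := mem_behaviour_map f |>.2 ⟨y', hy, rfl⟩
    rw [← key] at this
    exact (mem_behaviour_map f).1 this

/-- The quotient by a relation. -/
def quotSig (R : ∀ n m : ℕ, X n m → X n m → Prop) : Sig.{u} := fun n m => Quot (R n m)

/-- The projection to the quotient by a relation. -/
def quotProj (R : ∀ n m : ℕ, X n m → X n m → Prop) : X ⟶ quotSig R := ⟨fun x => Quot.mk _ x⟩

/-- The bisimulation clauses are what makes the structure on the quotient well defined. `R` need not
be an equivalence, since `Quot` identifies along the equivalence it generates. -/
theorem map_quotProj_eq {c : X ⟶ (Behaviour A κ).obj X}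
    {R : ∀ n m : ℕ, X n m → X n m → Prop} (hR : IsBisimulation c (fun {n m} => R n m))
    {n m : ℕ} {x y : X n m}
    (h : R n m x y) : ((Behaviour A κ).map (quotProj R)).app (c.app x) =
      ((Behaviour A κ).map (quotProj R)).app (c.app y) := by
  apply behaviour_ext
  intro v z w
  refine (mem_behaviour_map (quotProj R)).trans
    (Iff.trans ?_ (mem_behaviour_map (quotProj R)).symm)
  constructor
  · rintro ⟨x', hx, rfl⟩
    obtain ⟨y', hy, hxy⟩ := (hR x y h).1 v x' w hx
    exact ⟨y', hy, (Quot.sound hxy).symm⟩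
  · rintro ⟨y', hy, rfl⟩
    obtain ⟨x', hx, hxy⟩ := (hR x y h).2 v y' w hy
    exact ⟨x', hx, Quot.sound hxy⟩

/-- The quotient of a coalgebra by a bisimulation. -/
def quotStr {c : X ⟶ (Behaviour A κ).obj X} {R : ∀ n m : ℕ, X n m → X n m → Prop}
    (hR : IsBisimulation c (fun {n m} => R n m)) : quotSig R ⟶ (Behaviour A κ).obj (quotSig R) :=
  ⟨Quot.lift (fun x => ((Behaviour A κ).map (quotProj R)).app (c.app x))
    fun _ _ h => map_quotProj_eq hR h⟩

theorem bisimilar_iff {Ω : Endofunctor.Coalgebra (Behaviour A κ)} (hΩ : Limits.IsTerminal Ω)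
    (c : X ⟶ (Behaviour A κ).obj X) {n m : ℕ} (x y : X n m) :
    Bisimilar c x y ↔ (finalMap hΩ c).app x = (finalMap hΩ c).app y := by
  constructor
  · rintro ⟨R, hR, h⟩
    -- The projection to the quotient is a coalgebra morphism, so the final map factors through it
    -- and identifies related states.
    have e : quotProj (fun n m => R (n := n) (m := m)) ≫ finalMap hΩ (quotStr hR) = finalMap hΩ c :=
      final_hom_ext hΩ c (coalgebra_comp (c' := quotStr hR) rfl (finalMap_comm hΩ _))
        (finalMap_comm hΩ c)
    rw [← e]
    exact congrArg (finalMap hΩ (quotStr hR)).app (Quot.sound h)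
  · intro h
    exact ⟨_, isBisimulation_ker (finalMap_comm hΩ c), h⟩

end Bisimilarity

/-! ### Assembly -/

theorem mainTheorem3 (A : Type u) (κ : Cardinal.{u}) (hκ : ℵ₀ ≤ κ) (hA : #A ≤ κ) :
    -- the GSOS rules induce a unique distributive law of the free monad
    ∃ lamDag : DistributiveLaw SMMonad.{u} (Behaviour A κ),
      IsInducedBy lamDag (gsos A κ hκ hA) ∧
      (∀ d : DistributiveLaw SMMonad.{u} (Behaviour A κ),
        IsInducedBy d (gsos A κ hκ hA) → d = lamDag) ∧
      -- it preserves the equations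
      lamDag.Preserves SMEquations propProj ∧
      -- hence it descends uniquely to the prop monad
      ∃ lam : DistributiveLaw PropMonad.{u} (Behaviour A κ),
        lamDag.IsQuotient lam propProj ∧
        (∀ d : DistributiveLaw PropMonad.{u} (Behaviour A κ),
          lamDag.IsQuotient d propProj → d = lam) ∧
        -- a final coalgebra exists
        (∃ Ω : Endofunctor.Coalgebra (Behaviour A κ), Nonempty (Limits.IsTerminal Ω)) ∧
        -- every final coalgebra is a bialgebra and a prop, in a unique way
        ∀ (Ω : Endofunctor.Coalgebra (Behaviour A κ)) (hΩ : Limits.IsTerminal Ω),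
          ∃ a : PropMonad.obj Ω.V ⟶ Ω.V,
            IsBialgebra lam a Ω.str ∧
            (∀ b : PropMonad.obj Ω.V ⟶ Ω.V, IsBialgebra lam b Ω.str → b = a) ∧
            ∃ PΩ : PropStr Ω.V,
              PΩ.Realizes a ∧ (∀ Q : PropStr Ω.V, Q.Realizes a → Q = PΩ) ∧
              -- the semantics is a prop morphism
              ∀ (S : Sig.{u}) (β : S ⟶ (Behaviour A κ).obj (PropMonad.obj S)),
                IsBialgebra lam (PropMonad.μ.app S) (lam.sharp β) ∧
                ∃ PS : PropStr (PropMonad.obj S),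
                  PS.Realizes (PropMonad.μ.app S) ∧
                  (∀ Q : PropStr (PropMonad.obj S),
                    Q.Realizes (PropMonad.μ.app S) → Q = PS) ∧
                  PropMonad.map (semantics lam hΩ β) ≫ a =
                    PropMonad.μ.app S ≫ (semantics lam hΩ β) ∧
                  IsPropHom PS PΩ (semantics lam hΩ β) ∧
                  -- bisimilarity is equality of semantics, and it is a congruence
                  (∀ {n m : ℕ} (c d : PropMonad.obj S n m),
                    Bisimilar (lam.sharp β) c d ↔
                      (semantics lam hΩ β).app c =
                        (semantics lam hΩ β).app d) ∧
                  (∀ {n m : ℕ}, Equivalence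
                    (Bisimilar (lam.sharp β) (n := n) (m := m))) ∧
                  (∀ {n k m : ℕ} (c c' : PropMonad.obj S n k) (d d' : PropMonad.obj S k m),
                    Bisimilar (lam.sharp β) c c' → Bisimilar (lam.sharp β) d d' →
                      Bisimilar (lam.sharp β) (PS.seq c d) (PS.seq c' d')) ∧
                  (∀ {n m n' m' : ℕ} (c c' : PropMonad.obj S n m) (d d' : PropMonad.obj S n' m'),
                    Bisimilar (lam.sharp β) c c' → Bisimilar (lam.sharp β) d d' →
                      Bisimilar (lam.sharp β) (PS.par c d) (PS.par c' d')) := by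
  have hg := satisfies_liftAlgebra hκ hA
  refine ⟨inducedLaw _, inducedLaw_isInducedBy _, fun d hd => isInducedBy_unique _ hd,
    inducedLaw_preserves _ hg, quotientLaw _ hg, quotientLaw_isQuotient _ hg,
    fun d hd => isQuotient_unique _ hg hd, exists_final A κ, ?_⟩
  -- What remains holds for any distributive law of the prop monad over the behaviour functor, so
  -- its construction is forgotten.
  generalize quotientLaw (gsos A κ hκ hA) hg = lam
  intro Ω hΩ
  have bΩ := lam.finalAlgebra_isBialgebra hΩ
  obtain ⟨PΩ, hPΩ⟩ := PropStr.exists_realizes bΩ.unit bΩ.assoc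
  refine ⟨lam.finalAlgebra hΩ, bΩ, fun b hb => lam.finalAlgebra_unique hΩ hb, PΩ, hPΩ,
    fun Q hQ => hQ.unique hPΩ, fun S β => ?_⟩
  have bS := lam.sharp_isBialgebra β
  obtain ⟨PS, hPS⟩ := PropStr.exists_realizes bS.unit bS.assoc
  have halg := lam.finalMap_algebra hΩ bS
  have hom : IsPropHom PS PΩ (semantics lam hΩ β) := hPS.isPropHom hPΩ halg
  have hbis : ∀ {n m : ℕ} (c d : PropMonad.obj S n m), Bisimilar (lam.sharp β) c d ↔
      (semantics lam hΩ β).app c = (semantics lam hΩ β).app d := fun c d =>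
    bisimilar_iff hΩ (lam.sharp β) c d
  refine ⟨bS, PS, hPS, fun Q hQ => hQ.unique hPS, halg, hom, hbis, ?_, ?_, ?_⟩
  · intro n m
    exact ⟨fun c => (hbis c c).2 rfl, fun h => (hbis _ _).2 ((hbis _ _).1 h).symm,
      fun h h' => (hbis _ _).2 (((hbis _ _).1 h).trans ((hbis _ _).1 h'))⟩
  · intro n k m c c' d d' h h'
    rw [hbis, hom.map_seq, hom.map_seq, (hbis _ _).1 h, (hbis _ _).1 h']
  · intro n m n' m' c c' d d' h h'
    rw [hbis, hom.map_par, hom.map_par, (hbis _ _).1 h, (hbis _ _).1 h']
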